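/- **Theorem 4.2 (Well-posedness).** Let $\Omega\subset\mathbb R^3$ be open, $0<T<\infty$, $Q_T=\Omega\times{]0,T[}$, $H=L^2(\Omega)^3$, and identify $L^2(Q_T)^3$ with $L^2(0,T;H)$. Assume: (H1) the entries of the $3\times3$ matrices $\varepsilon(\cdot),\mu(\cdot)$ are bounded measurable functions in $\Omega$; (H2) $j(x,t,\xi)=j_0(x,t)+j_1(x,t,\xi)$, where $j_0\in L^2(Q_T)^3$ and $j_1:Q_T\times\mathbb R^3\to\mathbb R^3$ is a Carathéodory function, i.e. $j_1(\cdot,\cdot,\xi)$ is measurable in $Q_T$ for all $\xi$ and $j_1(x,t,\cdot)$ is continuous for a.e. $(x,t)\in Q_T$; (H3) there is $c_1>0$ with $|j_1(x,t,\xi)|\le c_1|\xi|$ for all $(x,t,\xi)\in Q_T\times\mathbb R^3$; (H5) $\varepsilon(x)$ and $\mu(x)$ are symmetric for all $x\in\Omega$; (H6) there are $\varepsilon_*,\mu_*>0$ with $\varepsilon(x)\xi\cdot\xi\ge\varepsilon_*|\xi|^2$ and $\mu(x)\xi\cdot\xi\ge\mu_*|\xi|^2$ for all $x\in\Omega$,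 $\xi\in\mathbb R^3$; (H7) $(j(x,t,\xi)-j(x,t,\eta))\cdot(\xi-\eta)\ge0$ for all $(x,t)\in Q_T$ and $\xi,\eta\in\mathbb R^3$. Let $V$ be the Hilbert space of all $u\in H$ whose distributional curl is represented by an element $\operatorname{curl}u\in H$, i.e. $\int_\Omega u\cdot\operatorname{curl}\varphi\,dx=\int_\Omega\operatorname{curl}u\cdot\varphi\,dx$ for all $\varphi\in C_c^\infty(\Omega)^3$, with scalar product $(u,v)_V=\int_\Omega(u\cdot v+\operatorname{curl}u\cdot\operatorname{curl}v)\,dx$, and let $V_0$ be the subspace of all $u\in V$ with $\int_\Omega\operatorname{curl}u\cdot\psi\,dx=\int_\Omega u\cdot\operatorname{curl}\psi\,dx$ for all $\psi\in V$. For initial data $(e_0,h_0)\in H\times H$, a pair $(e,h)\in L^2(Q_T)^3\times L^2(Q_T)^3$ is a *weak solution* (of $\partial_t(\varepsilon e)=\operatorname{curl}h-j(x,t,e)$, $\partial_t(\mu h)=-\operatorname{curl}e$ in $Q_T$, $n\times e=0$ on $\partial\Omega\times{]0,T[}$, $e=e_0$, $h=h_0$ at $t=0$) if $$-\int_{Q_T}(\varepsilon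 e)\cdot\partial_t\Phi\,dx\,dt+\int_{Q_T}\big(-h\cdot\operatorname{curl}\Phi+j(x,t,e)\cdot\Phi\big)\,dx\,dt=\int_\Omega(\varepsilon e_0)\cdot\Phi(\cdot,0)\,dx$$ for all $\Phi\in L^2(0,T;V_0)$ with $\partial_t\Phi\in L^2(Q_T)^3$ and $\Phi(\cdot,T)=0$, and $$-\int_{Q_T}(\mu h)\cdot\partial_t\Psi\,dx\,dt+\int_{Q_T}e\cdot\operatorname{curl}\Psi\,dx\,dt=\int_\Omega(\mu h_0)\cdot\Psi(\cdot,0)\,dx$$ for all $\Psi\in L^2(0,T;V)$ with $\partial_t\Psi\in L^2(Q_T)^3$ and $\Psi(\cdot,T)=0$. (The values at $t=0,T$ of a test function are those of its representative in $C([0,T];H)$.) Let $(e^{(k)},h^{(k)})$, $k=1,2$, be weak solutions with initial data $(e_0^{(k)},h_0^{(k)})\in H\times H$. Then $e^{(k)},h^{(k)}$ have representatives in $C([0,T];H)$, denoted by the same symbols, with $e^{(k)}(0)=e_0^{(k)}$, $h^{(k)}(0)=h_0^{(k)}$, and for all $t\in[0,T]$ $$\|e^{(1)}(t)-e^{(2)}(t)\|_{H_\varepsilon}^2+\|h^{(1)}(t)-h^{(2)}(t)\|_{H_\mu}^2\le\|e_0^{(1)}-e_0^{(2)}\|_{H_\varepsilon}^2+\|h_0^{(1)}-h_0^{(2)}\|_{H_\mu}^2,$$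 where $\|u\|_{H_\varepsilon}^2=\int_\Omega\varepsilon u\cdot u\,dx$ and $\|u\|_{H_\mu}^2=\int_\Omega\mu u\cdot u\,dx$. In particular, weak solutions with the same initial data coincide in $L^2(Q_T)^3\times L^2(Q_T)^3$, and weak solutions depend continuously on the initial data: there is a constant $C>0$ depending only on $\Omega$, $\varepsilon$ and $\mu$ such that, for all $t\in[0,T]$, $$\|e^{(1)}(t)-e^{(2)}(t)\|_H^2+\|h^{(1)}(t)-h^{(2)}(t)\|_H^2\le C\big(\|e_0^{(1)}-e_0^{(2)}\|_H^2+\|h_0^{(1)}-h_0^{(2)}\|_H^2\big).$$ -/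

import Mathlib

open MeasureTheory Set
open scoped ContDiff

noncomputable section

namespace Maxwell

/-- Euclidean three-space `ℝ³`. -/
abbrev E3 : Type := EuclideanSpace ℝ (Fin 3)

/-- The scalar product `a · b` of `ℝ³`. -/
abbrev dot (a b : E3) : ℝ := inner ℝ a b

/-- The matrix-vector product `A ξ`, for `ξ ∈ ℝ³`. -/
def mulVec3 (A : Matrix (Fin 3) (Fin 3) ℝ) (ξ : E3) : E3 :=
  WithLp.toLp 2 (A.mulVec ξ.ofLp)

/-- The space `H = L²(Ω)³`, with its standard scalar product. -/
abbrev H (Ω : Set E3) : Type := Lp E3 2 (volume.restrict Ω)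

/-- The cylinder `Q_T = Ω × ]0,T[`. -/
def QT (Ω : Set E3) (T : ℝ) : Set (E3 × ℝ) := Ω ×ˢ Ioo 0 T

/-- The space `L²(Q_T)³`. -/
abbrev L2Q (Ω : Set E3) (T : ℝ) : Type := Lp E3 2 (volume.restrict (QT Ω T))

/-- The partial derivative `∂ᵢ φₖ` at `x`. -/
def pderiv (φ : E3 → E3) (i k : Fin 3) (x : E3) : ℝ :=
  (fderiv ℝ φ x (EuclideanSpace.single i 1)) k

/-- The classical curl of a differentiable vector field. -/
def curl (φ : E3 → E3) (x : E3) : E3 :=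
  !₂[pderiv φ 1 2 x - pderiv φ 2 1 x,
     pderiv φ 2 0 x - pderiv φ 0 2 x,
     pderiv φ 0 1 x - pderiv φ 1 0 x]

/-- The space `C_c^∞(Ω)³`. -/
def IsTestField (Ω : Set E3) (φ : E3 → E3) : Prop :=
  ContDiff ℝ ∞ φ ∧ HasCompactSupport φ ∧ tsupport φ ⊆ Ω

/-- `F ∈ L²(Ω)³` represents the distributional curl of `u ∈ L²(Ω)³` in `Ω`. -/
def HasWeakCurl {Ω : Set E3} (u F : H Ω) : Prop :=
  ∀ φ : E3 → E3, IsTestField Ω φ →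
    ∫ x in Ω, dot (u x) (curl φ x) = ∫ x in Ω, dot (F x) (φ x)

theorem pderiv_continuous {φ : E3 → E3} (hφ : ContDiff ℝ ∞ φ) (i k : Fin 3) :
    Continuous (pderiv φ i k) := by
  have h1 : Continuous fun x => fderiv ℝ φ x (EuclideanSpace.single i (1 : ℝ)) :=
    (hφ.continuous_fderiv (by simp)).clm_apply continuous_const
  unfold pderiv
  fun_prop

theorem pderiv_hasCompactSupport {φ : E3 → E3} (hφ : HasCompactSupport φ) (i k : Fin 3) :
    HasCompactSupport (pderiv φ i k) :=
  HasCompactSupport.comp_left (g := fun L : E3 →L[ℝ] E3 => (L (EuclideanSpace.single i 1)) k)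
    (hφ.fderiv (𝕜 := ℝ)) (by simp)

theorem curl_memLp {φ : E3 → E3} (hφ : ContDiff ℝ ∞ φ) (hc : HasCompactSupport φ)
    (ν : Measure E3) [IsFiniteMeasureOnCompacts ν] : MemLp (curl φ) 2 ν := by
  refine MemLp.of_eval_piLp fun i => ?_
  have h : ∀ i k : Fin 3, MemLp (pderiv φ i k) 2 ν := fun i k =>
    (pderiv_continuous hφ i k).memLp_of_hasCompactSupport (pderiv_hasCompactSupport hc i k)
  fin_cases i
  · exact (h 1 2).sub (h 2 1)
  · exact (h 2 0).sub (h 0 2)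
  · exact (h 0 1).sub (h 1 0)

/-- The ambient Hilbert space `H × H`, with the scalar product
`((u,F),(v,G)) ↦ (u,v)_H + (F,G)_H`. -/
abbrev HH (Ω : Set E3) : Type := WithLp 2 (H Ω × H Ω)

theorem integrable_dot {Ω : Set E3} (u : H Ω) {w : E3 → E3}
    (hw : MemLp w 2 (volume.restrict Ω)) :
    Integrable (fun x => dot (u x) (w x)) (volume.restrict Ω) := by
  refine (L2.integrable_inner (𝕜 := ℝ) u (hw.toLp w)).congr ?_
  filter_upwards [hw.coeFn_toLp] with x hx
  rw [hx]

theorem integral_dot_add {Ω : Set E3} (u v : H Ω) {w : E3 → E3}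
    (hw : MemLp w 2 (volume.restrict Ω)) :
    ∫ x in Ω, dot ((u + v : H Ω) x) (w x)
      = (∫ x in Ω, dot (u x) (w x)) + ∫ x in Ω, dot (v x) (w x) := by
  rw [← integral_add]
  · refine integral_congr_ae ?_
    filter_upwards [Lp.coeFn_add u v] with x hx
    simp only [dot]
    rw [hx, Pi.add_apply, inner_add_left]
  · exact integrable_dot u hw
  · exact integrable_dot v hw

theorem integral_dot_smul {Ω : Set E3} (c : ℝ) (u : H Ω) (w : E3 → E3) :
    ∫ x in Ω, dot ((c • u : H Ω) x) (w x) = c * ∫ x in Ω, dot (u x) (w x) := by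
  rw [← integral_const_mul]
  refine integral_congr_ae ?_
  filter_upwards [Lp.coeFn_smul c u] with x hx
  simp only [dot]
  rw [hx, Pi.smul_apply, real_inner_smul_left]

/-- The distributional curl is determined by the field. -/
theorem HasWeakCurl.unique {Ω : Set E3} (hΩ : IsOpen Ω) {u F G : H Ω}
    (hF : HasWeakCurl u F) (hG : HasWeakCurl u G) : F = G := by
  have hm : MemLp (fun x => (F x - G x : E3)) 2 (volume.restrict Ω) :=
    (Lp.memLp F).sub (Lp.memLp G)
  have hli : LocallyIntegrableOn (fun x => (F x - G x : E3)) Ω volume := by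
    rw [locallyIntegrableOn_iff hΩ.isLocallyClosed]
    intro k hk hkc
    have := (hm.locallyIntegrable (by norm_num)).integrableOn_isCompact hkc
    rwa [IntegrableOn, Measure.restrict_restrict hkc.measurableSet, inter_eq_left.2 hk] at this
  have := hΩ.ae_eq_zero_of_integral_contDiff_smul_eq_zero hli ?_
  · apply Lp.ext
    rw [Filter.EventuallyEq, ae_restrict_iff' hΩ.measurableSet]
    filter_upwards [this] with x hx hxΩ
    exact sub_eq_zero.1 (hx hxΩ)
  · intro g hg hgc hgs
    have hgm : MemLp g 2 (volume.restrict Ω) := hg.continuous.memLp_of_hasCompactSupport hgc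
    have hint : Integrable (fun x => g x • (F x - G x : E3)) (volume.restrict Ω) :=
      memLp_one_iff_integrable.1 (hm.smul hgm)
    have h0 : ∫ x, g x • (F x - G x : E3) = ∫ x in Ω, g x • (F x - G x : E3) := by
      symm
      apply setIntegral_eq_integral_of_forall_compl_eq_zero
      intro x hx
      rw [image_eq_zero_of_notMem_tsupport (fun h => hx (hgs h)), zero_smul]
    rw [h0]
    refine ext_inner_left ℝ fun v => ?_
    rw [← integral_inner hint, inner_zero_right]
    have htf : IsTestField Ω (fun x => g x • v) :=
      ⟨hg.smul contDiff_const, hgc.smul_right, (tsupport_smul_subset_left _ _).trans hgs⟩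
    have h1 := (hF _ htf).symm.trans (hG _ htf)
    have hv : MemLp (fun x => g x • v) 2 (volume.restrict Ω) :=
      htf.1.continuous.memLp_of_hasCompactSupport htf.2.1
    rw [← sub_eq_zero, ← integral_sub (integrable_dot F hv) (integrable_dot G hv)] at h1
    rw [← h1]
    congr 1
    ext x
    simp only [dot, inner_smul_right, inner_sub_right, real_inner_comm]
    ring

/-- The Hilbert space `V = H(curl; Ω)` with the scalar product
`(u,v)_V = ∫_Ω (u · v + curl u · curl v)`. Since `curl u` is determined by `u`, an element `u`
is recorded together with its curl, as the pair `(u, curl u)`. -/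
def V (Ω : Set E3) : Submodule ℝ (HH Ω) where
  carrier := {w | HasWeakCurl w.fst w.snd}
  zero_mem' := by
    intro φ _
    have h := integral_dot_smul (Ω := Ω) 0 0 (curl φ)
    have h' := integral_dot_smul (Ω := Ω) 0 0 φ
    simp only [zero_smul, zero_mul] at h h'
    exact h.trans h'.symm
  add_mem' := by
    intro a b ha hb φ hφ
    have h1 := curl_memLp hφ.1 hφ.2.1 (volume.restrict Ω)
    have h2 : MemLp φ 2 (volume.restrict Ω) :=
      hφ.1.continuous.memLp_of_hasCompactSupport hφ.2.1
    have h3 := integral_dot_add a.fst b.fst h1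
    have h4 := integral_dot_add a.snd b.snd h2
    rw [ha φ hφ, hb φ hφ] at h3
    exact h3.trans h4.symm
  smul_mem' := by
    intro c a ha φ hφ
    have h3 := integral_dot_smul c a.fst (curl φ)
    have h4 := integral_dot_smul c a.snd φ
    rw [ha φ hφ] at h3
    exact h3.trans h4.symm

/-- The closed subspace `V₀` of all `u ∈ V` with `∫_Ω curl u · ψ = ∫_Ω u · curl ψ`
for all `ψ ∈ V`. -/
def V₀ (Ω : Set E3) : Submodule ℝ (HH Ω) where
  carrier := {w | w ∈ V Ω ∧ ∀ ψ ∈ V Ω,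
    ∫ x in Ω, dot (w.snd x) (ψ.fst x) = ∫ x in Ω, dot (w.fst x) (ψ.snd x)}
  zero_mem' := by
    refine ⟨zero_mem _, fun ψ _ => ?_⟩
    have h := integral_dot_smul (Ω := Ω) 0 0 ψ.fst
    have h' := integral_dot_smul (Ω := Ω) 0 0 ψ.snd
    simp only [zero_smul, zero_mul] at h h'
    exact h.trans h'.symm
  add_mem' := by
    rintro a b ⟨ha, ha'⟩ ⟨hb, hb'⟩
    refine ⟨add_mem ha hb, fun ψ hψ => ?_⟩
    have h3 := integral_dot_add a.snd b.snd (Lp.memLp ψ.fst)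
    have h4 := integral_dot_add a.fst b.fst (Lp.memLp ψ.snd)
    rw [ha' ψ hψ, hb' ψ hψ] at h3
    exact h3.trans h4.symm
  smul_mem' := by
    rintro c a ⟨ha, ha'⟩
    refine ⟨Submodule.smul_mem _ c ha, fun ψ hψ => ?_⟩
    have h3 := integral_dot_smul c a.snd ψ.fst
    have h4 := integral_dot_smul c a.fst ψ.snd
    rw [ha' ψ hψ] at h3
    exact h3.trans h4.symm

/-- `U` is the derivative of `u` in the sense of distributions from `[0,T]` into `H`:
`∫₀ᵀ ζ̇ u dt = - ∫₀ᵀ ζ U dt` in `H` for all `ζ ∈ C_c^∞(]0,T[)`. -/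
def HasDistribDeriv {Ω : Set E3} (T : ℝ) (u U : ℝ → H Ω) : Prop :=
  ∀ ζ : ℝ → ℝ, ContDiff ℝ ∞ ζ → HasCompactSupport ζ → tsupport ζ ⊆ Ioo 0 T →
    ∫ t in Ioo 0 T, deriv ζ t • u t = - ∫ t in Ioo 0 T, ζ t • U t

/-- The admissible test functions with values in `W` (with `W = V₀ Ω` or `W = V Ω`):
`Φ ∈ L²(0,T;W)`, `∂ₜΦ = Φt ∈ L²(0,T;H) ≅ L²(Q_T)³`, and `Φ(·,T) = 0`. Here `Φc` is the
representative in `C([0,T];H)` of `Φ`, through which the values `Φ(·,0)` and `Φ(·,T)`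
are understood. -/
structure IsAdmissible {Ω : Set E3} (T : ℝ) (W : Submodule ℝ (HH Ω))
    (Φ : ℝ → W) (Φt Φc : ℝ → H Ω) : Prop where
  memLp : MemLp Φ 2 (volume.restrict (Ioo 0 T))
  memLp_deriv : MemLp Φt 2 (volume.restrict (Ioo 0 T))
  hasDeriv : HasDistribDeriv T (fun t => (Φ t : HH Ω).fst) Φt
  continuousOn : ContinuousOn Φc (Icc 0 T)
  ae_eq : ∀ᵐ t ∂(volume.restrict (Ioo 0 T)), Φc t = (Φ t : HH Ω).fst
  final : Φc T = 0

/-- Weak solutions `(e,h) ∈ L²(Q_T)³ × L²(Q_T)³` of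
`∂ₜ(εe) = curl h - j(x,t,e)`, `∂ₜ(μh) = - curl e` in `Q_T`, `n × e = 0` on `∂Ω × ]0,T[`,
`e(·,0) = e₀`, `h(·,0) = h₀`. The integrals over `Q_T` are written as iterated integrals,
since `∂ₜΦ`, `curl Φ` and `Φ` are elements of `L²(0,T;H) ≅ L²(Q_T)³`. -/
structure IsWeakSolution (Ω : Set E3) (T : ℝ) (ε μ : E3 → Matrix (Fin 3) (Fin 3) ℝ)
    (j : E3 × ℝ → E3 → E3) (e₀ h₀ : H Ω) (e h : L2Q Ω T) : Prop where
  electric : ∀ (Φ : ℝ → V₀ Ω) (Φt Φc : ℝ → H Ω), IsAdmissible T (V₀ Ω) Φ Φt Φc →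
    - (∫ t in Ioo 0 T, ∫ x in Ω, dot (mulVec3 (ε x) (e (x, t))) (Φt t x))
      + (∫ t in Ioo 0 T, ∫ x in Ω,
          (- dot (h (x, t)) ((Φ t : HH Ω).snd x)
            + dot (j (x, t) (e (x, t))) ((Φ t : HH Ω).fst x)))
      = ∫ x in Ω, dot (mulVec3 (ε x) (e₀ x)) (Φc 0 x)
  magnetic : ∀ (Ψ : ℝ → V Ω) (Ψt Ψc : ℝ → H Ω), IsAdmissible T (V Ω) Ψ Ψt Ψc →
    - (∫ t in Ioo 0 T, ∫ x in Ω, dot (mulVec3 (μ x) (h (x, t))) (Ψt t x))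
      + (∫ t in Ioo 0 T, ∫ x in Ω, dot (e (x, t)) ((Ψ t : HH Ω).snd x))
      = ∫ x in Ω, dot (mulVec3 (μ x) (h₀ x)) (Ψc 0 x)

/-- The entries of the matrix field `A` are bounded measurable functions in `Ω`. -/
def BoundedMeasurable (Ω : Set E3) (A : E3 → Matrix (Fin 3) (Fin 3) ℝ) : Prop :=
  (∀ i k, AEMeasurable (fun x => A x i k) (volume.restrict Ω)) ∧
    ∃ M : ℝ, ∀ x ∈ Ω, ∀ i k, |A x i k| ≤ M

/-- The matrix field `A` is uniformly positive definite in `Ω`. -/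
def UniformlyPositive (Ω : Set E3) (A : E3 → Matrix (Fin 3) (Fin 3) ℝ) : Prop :=
  ∃ a : ℝ, 0 < a ∧ ∀ x ∈ Ω, ∀ ξ : E3, a * ‖ξ‖ ^ 2 ≤ dot (mulVec3 (A x) ξ) ξ

/-- `j₁` is a Carathéodory function on `Q_T × ℝ³`. -/
def IsCaratheodory (Ω : Set E3) (T : ℝ) (j₁ : E3 × ℝ → E3 → E3) : Prop :=
  (∀ ξ : E3, AEMeasurable (fun p => j₁ p ξ) (volume.restrict (QT Ω T))) ∧
    ∀ᵐ p ∂(volume.restrict (QT Ω T)), Continuous (j₁ p)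

/-- The weighted square norm `‖u‖²_{H_A} = ∫_Ω (A u) · u`. -/
def weightedSq {Ω : Set E3} (A : E3 → Matrix (Fin 3) (Fin 3) ℝ) (u : H Ω) : ℝ :=
  ∫ x in Ω, dot (mulVec3 (A x) (u x)) (u x)

/-- `uc ∈ C([0,T];H)` is the continuous representative of `u ∈ L²(Q_T)³ ≅ L²(0,T;H)`, that is,
`uc(t) = u(·,t)` in `H` for a.e. `t`. -/
def IsContRep {Ω : Set E3} {T : ℝ} (u : L2Q Ω T) (uc : ℝ → H Ω) : Prop :=
  ContinuousOn uc (Icc 0 T) ∧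
    ∀ᵐ t ∂(volume.restrict (Ioo 0 T)), ∀ᵐ x ∂(volume.restrict Ω), uc t x = u (x, t)

end Maxwell

end

open Maxwell

/-! Put w = (e, h), M = diag(ε, μ) on H × H, and B(e, h) = (curl h, -curl e) on V₀ × V. A weak
solution satisfies (M w)' = B w - g with g = (j(·, e), 0). Linear growth makes g square integrable,
so it can be treated as a given source. M is symmetric and coercive with some constant a > 0. B is
skew-adjoint because V and V₀ are exactly dual to each other under the curl pairing
(`isSkewAdjointGraph_maxwellGraph`); this duality encodes the boundary condition, so no regularity
of ∂Ω is needed. Formally, pairing with w kills ⟨B w, w⟩ and leaves ⟨M w, w⟩' = -2⟨g, w⟩. For the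
difference of two solutions, monotonicity of j makes the right side nonpositive, and this is the
estimate.

The obstacle is that w need be neither in the domain of B nor differentiable in time. The resolvent
R = (M - c B)⁻¹ repairs both defects. It is bounded by 1/a uniformly in c and takes values in the
domain of B. Its adjoint (M + c B)⁻¹ also maps into the domain and so provides test vectors, which
shows that R M w agrees a.e. with a primitive of an integrable function
(`IsEvolutionSolution.regularization`). For such a primitive the energy identity is an exact product
rule (`energy_identity_of_domain`).

As c tends to 0, R M tends strongly to the identity (`tendsto_resolvent`). The energy identity
applied to differences of regularizations makes them uniformly Cauchy on [0, T]. Their limit is a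
continuous representative of w with the right initial value, and the identity survives the limit
(`IsEvolutionSolution.exists_continuous`). With the source kept as a datum the equation is linear,
so the same result applies to the difference of two solutions
(`IsEvolutionSolution.exists_continuous_pair`). -/

/-! ### Integration by parts for Bochner primitives. -/

section Parts

variable {E F G : Type*} [NormedAddCommGroup E] [NormedSpace ℝ E]
  [NormedAddCommGroup F] [NormedSpace ℝ F]
  [NormedAddCommGroup G] [NormedSpace ℝ G]

/-- Product rule for two primitives vanishing at `0`, under a continuous bilinear map. -/
theorem bilin_integral_integral [CompleteSpace E] [CompleteSpace F] [CompleteSpace G]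
    (B : E →L[ℝ] F →L[ℝ] G) {f : ℝ → E} {g : ℝ → F} {t : ℝ}
    (hf : IntegrableOn f (Ioc 0 t)) (hg : IntegrableOn g (Ioc 0 t)) :
    B (∫ s in Ioc 0 t, f s) (∫ s in Ioc 0 t, g s)
      = (∫ s in Ioc 0 t, B (f s) (∫ r in Ioc 0 s, g r))
        + ∫ s in Ioc 0 t, B (∫ r in Ioc 0 s, f r) (g s) := by
  set ν : Measure ℝ := volume.restrict (Ioc 0 t) with hν
  have hk : Integrable (fun z : ℝ × ℝ => B (f z.1) (g z.2)) (ν.prod ν) :=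
    Integrable.op_fst_snd (op := fun x y => B x y)
      (by exact B.continuous₂) ⟨‖B‖, fun x y => B.le_opNorm₂ x y⟩ hf hg
  have hS : MeasurableSet {z : ℝ × ℝ | z.2 ≤ z.1} := measurableSet_le measurable_snd measurable_fst
  have h1 : B (∫ s, f s ∂ν) (∫ s, g s ∂ν) = ∫ z, B (f z.1) (g z.2) ∂(ν.prod ν) := by
    rw [integral_prod _ hk, ← ContinuousLinearMap.flip_apply,
      ← ContinuousLinearMap.integral_comp_comm _ hf]
    refine integral_congr_ae (Filter.Eventually.of_forall fun s => ?_)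
    simp only [ContinuousLinearMap.flip_apply]
    exact ((B (f s)).integral_comp_comm hg).symm
  -- The product of the integrals is a double integral over a square; cutting it along the diagonal
  -- gives one term of the product rule per triangle, with no differentiation of primitives.
  rw [h1, ← integral_add_compl hS hk, ← integral_indicator hS, ← integral_indicator hS.compl,
    integral_prod _ (hk.indicator hS), integral_prod_symm _ (hk.indicator hS.compl)]
  congr 1
  · refine setIntegral_congr_fun measurableSet_Ioc fun s hs => ?_
    have hgs : IntegrableOn g (Ioc 0 s) := hg.mono_set (Ioc_subset_Ioc_right hs.2)
    rw [← (B (f s)).integral_comp_comm hgs]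
    have : ∀ r, {z : ℝ × ℝ | z.2 ≤ z.1}.indicator (fun z : ℝ × ℝ => B (f z.1) (g z.2)) (s, r)
        = (Iic s).indicator (fun r => B (f s) (g r)) r := fun r => by
      simp [indicator_apply]
    simp_rw [this]
    rw [integral_indicator measurableSet_Iic, hν, Measure.restrict_restrict measurableSet_Iic]
    congr 2
    ext r
    simp only [mem_inter_iff, mem_Iic, mem_Ioc]
    constructor
    · rintro ⟨h, h', -⟩
      exact ⟨h', h⟩
    · rintro ⟨h, h'⟩
      exact ⟨h', h, h'.trans hs.2⟩
  · refine setIntegral_congr_fun measurableSet_Ioc fun s hs => ?_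
    have hfs : IntegrableOn f (Ioc 0 s) := hf.mono_set (Ioc_subset_Ioc_right hs.2)
    rw [← ContinuousLinearMap.flip_apply, ← (B.flip (g s)).integral_comp_comm hfs]
    have : ∀ r, {z : ℝ × ℝ | z.2 ≤ z.1}ᶜ.indicator (fun z : ℝ × ℝ => B (f z.1) (g z.2)) (r, s)
        = (Iio s).indicator (fun r => B (f r) (g s)) r := fun r => by
      simp [indicator_apply]
    simp_rw [this]
    -- The complementary triangle is strict, so its sections are half-lines without endpoint; the
    -- missing point is null.
    rw [integral_indicator measurableSet_Iio, hν, Measure.restrict_restrict measurableSet_Iio,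
      integral_Ioc_eq_integral_Ioo]
    simp only [ContinuousLinearMap.flip_apply]
    congr 2
    ext r
    simp only [mem_inter_iff, mem_Iio, mem_Ioc, mem_Ioo]
    constructor
    · rintro ⟨h, h', -⟩
      exact ⟨h', h⟩
    · rintro ⟨h, h'⟩
      exact ⟨h', h, h'.le.trans hs.2⟩

theorem continuousOn_primitive_Ioc {f : ℝ → E} {T : ℝ} (hf : IntegrableOn f (Ioc 0 T)) :
    ContinuousOn (fun t => ∫ s in Ioc 0 t, f s) (Icc 0 T) :=
  intervalIntegral.continuousOn_primitive ((integrableOn_Icc_iff_integrableOn_Ioc (by simp)).2 hf)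

theorem integrableOn_bilin_left (B : E →L[ℝ] F →L[ℝ] G) {f : ℝ → E} {U : ℝ → F} {t : ℝ}
    (hf : IntegrableOn f (Ioc 0 t)) (hU : ContinuousOn U (Icc 0 t)) :
    IntegrableOn (fun s => B (f s) (U s)) (Ioc 0 t) := by
  obtain ⟨C, hC⟩ := isCompact_Icc.exists_bound_of_continuousOn hU
  refine B.integrable_of_bilin_of_bdd_right C hf
    ((hU.mono Ioc_subset_Icc_self).aestronglyMeasurable measurableSet_Ioc) ?_
  exact (ae_restrict_iff' measurableSet_Ioc).2
    (Filter.Eventually.of_forall fun s hs => hC s (Ioc_subset_Icc_self hs))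

/-- Product rule for two primitives under a continuous bilinear map. -/
theorem bilin_primitive_primitive [CompleteSpace E] [CompleteSpace F] [CompleteSpace G]
    (B : E →L[ℝ] F →L[ℝ] G) {f : ℝ → E} {g : ℝ → F} {t : ℝ}
    (hf : IntegrableOn f (Ioc 0 t)) (hg : IntegrableOn g (Ioc 0 t)) (u : E) (v : F) :
    B (u + ∫ s in Ioc 0 t, f s) (v + ∫ s in Ioc 0 t, g s)
      = B u v + (∫ s in Ioc 0 t, B (f s) (v + ∫ r in Ioc 0 s, g r))
        + ∫ s in Ioc 0 t, B (u + ∫ r in Ioc 0 s, f r) (g s) := by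
  have hF := continuousOn_primitive_Ioc hf
  have hG := continuousOn_primitive_Ioc hg
  have e1 : ∫ s in Ioc 0 t, B (f s) (v + ∫ r in Ioc 0 s, g r)
      = B (∫ s in Ioc 0 t, f s) v + ∫ s in Ioc 0 t, B (f s) (∫ r in Ioc 0 s, g r) := by
    simp only [map_add]
    rw [integral_add (integrableOn_bilin_left B hf continuousOn_const)
      (integrableOn_bilin_left B hf hG), ← ContinuousLinearMap.flip_apply B _ v,
      ← (B.flip v).integral_comp_comm hf]
    rfl
  have hFg : IntegrableOn (fun s => B (∫ r in Ioc 0 s, f r) (g s)) (Ioc 0 t) :=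
    integrableOn_bilin_left B.flip hg hF
  have e2 : ∫ s in Ioc 0 t, B (u + ∫ r in Ioc 0 s, f r) (g s)
      = B u (∫ s in Ioc 0 t, g s) + ∫ s in Ioc 0 t, B (∫ r in Ioc 0 s, f r) (g s) := by
    simp only [map_add, add_apply]
    rw [integral_add ((B u).integrable_comp hg)
      hFg, ← (B u).integral_comp_comm hg]
  rw [e1, e2]
  have := bilin_integral_integral B hf hg
  simp only [map_add, add_apply]
  rw [this]
  abel

end Parts

/-! ### Skew-adjoint graphs and their resolvents. -/

section SkewAdjoint

open scoped InnerProductSpace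
open Filter Topology

variable {X : Type*} [NormedAddCommGroup X] [InnerProductSpace ℝ X]

/-- The graph `G` of a densely defined skew-adjoint operator. -/
structure IsSkewAdjointGraph (G : Submodule ℝ (X × X)) : Prop where
  mem_iff : ∀ u v : X, (u, v) ∈ G ↔ ∀ p ∈ G, ⟪u, p.2⟫_ℝ + ⟪v, p.1⟫_ℝ = 0
  eq_zero : ∀ v : X, (0, v) ∈ G → v = 0

/-- `M` is a symmetric bounded operator with `a ‖u‖² ≤ ⟪M u, u⟫`, where `a > 0`. -/
structure IsCoerciveSymm (M : X →L[ℝ] X) (a : ℝ) : Prop where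
  pos : 0 < a
  symm : ∀ u v, ⟪M u, v⟫_ℝ = ⟪u, M v⟫_ℝ
  le : ∀ u, a * ‖u‖ ^ 2 ≤ ⟪M u, u⟫_ℝ

namespace IsSkewAdjointGraph

variable {G : Submodule ℝ (X × X)}

theorem skew (hG : IsSkewAdjointGraph G) {p q : X × X} (hp : p ∈ G) (hq : q ∈ G) :
    ⟪p.1, q.2⟫_ℝ + ⟪p.2, q.1⟫_ℝ = 0 :=
  (hG.mem_iff p.1 p.2).1 hp q hq

theorem inner_self (hG : IsSkewAdjointGraph G) {p : X × X} (hp : p ∈ G) :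
    ⟪p.2, p.1⟫_ℝ = 0 := by
  have := hG.skew hp hp
  rw [real_inner_comm] at this
  linarith

/-- A graph that equals its own skew-adjoint is an intersection of zero sets of continuous
functions. -/
theorem isClosed (hG : IsSkewAdjointGraph G) : IsClosed (G : Set (X × X)) := by
  have : (G : Set (X × X)) = ⋂ p ∈ G, {z : X × X | ⟪z.1, p.2⟫_ℝ + ⟪z.2, p.1⟫_ℝ = 0} := by
    ext z
    simp only [SetLike.mem_coe, mem_iInter, mem_ofPred_eq]
    exact hG.mem_iff z.1 z.2
  rw [this]
  exact isClosed_biInter fun p _ => isClosed_eq (by fun_prop) continuous_const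

variable {M : X →L[ℝ] X} {a : ℝ}

/-- The domain of a skew-adjoint operator is dense. -/
theorem dense_domain [CompleteSpace X] (hG : IsSkewAdjointGraph G) (u : X) {r : ℝ} (hr : 0 < r) :
    ∃ p ∈ G, ‖u - p.1‖ < r := by
  set D : Submodule ℝ X := G.map (LinearMap.fst ℝ X X)
  have hD : D.topologicalClosure = ⊤ := by
    rw [Submodule.topologicalClosure_eq_top_iff, Submodule.eq_bot_iff]
    intro v hv
    -- A vector orthogonal to the domain satisfies the adjoint relation with first component 0, so
    -- single-valuedness forces it to vanish.
    refine hG.eq_zero v ((hG.mem_iff 0 v).2 fun p hp => ?_)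
    rw [inner_zero_left, zero_add, real_inner_comm]
    exact (Submodule.mem_orthogonal D v).1 hv p.1 ⟨p, hp, rfl⟩
  have hu : u ∈ closure (D : Set X) := by
    rw [← Submodule.topologicalClosure_coe, hD]
    trivial
  obtain ⟨x, ⟨p, hp, rfl⟩, hx⟩ := Metric.mem_closure_iff.1 hu r hr
  exact ⟨p, hp, by simpa [dist_eq_norm] using hx⟩

/-- Pairing with `p.1` removes the skew term, so coercivity of M alone controls `p.1`, with a
constant independent of c. -/
theorem coercive_bound (hG : IsSkewAdjointGraph G) (hM : IsCoerciveSymm M a) {p : X × X}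
    (hp : p ∈ G) (c : ℝ) : a * ‖p.1‖ ≤ ‖M p.1 + c • p.2‖ := by
  have h1 : ⟪M p.1 + c • p.2, p.1⟫_ℝ = ⟪M p.1, p.1⟫_ℝ := by
    rw [inner_add_left, inner_smul_left, hG.inner_self hp]
    simp
  have h2 := hM.le p.1
  have h3 := real_inner_le_norm (M p.1 + c • p.2) p.1
  rw [h1] at h3
  rcases (norm_nonneg p.1).eq_or_lt with h | h
  · rw [← h, mul_zero]
    exact norm_nonneg _
  · refine le_of_mul_le_mul_right ?_ h
    nlinarith

/-- `M + c B` is onto when `B` is skew-adjoint and `c ≠ 0`. -/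
theorem exists_solution [CompleteSpace X] (hG : IsSkewAdjointGraph G) (hM : IsCoerciveSymm M a) {c : ℝ}
    (hc : c ≠ 0) (y : X) : ∃ p ∈ G, M p.1 + c • p.2 = y := by
  let L : G →L[ℝ] X :=
    (M ∘L ContinuousLinearMap.fst ℝ X X + c • ContinuousLinearMap.snd ℝ X X) ∘L G.subtypeL
  have hL : ∀ p : G, L p = M p.1.1 + c • p.1.2 := fun p => rfl
  have hcomp : CompleteSpace G := hG.isClosed.completeSpace_coe
  have hc' : 0 < ‖c‖ := norm_pos_iff.2 hc
  -- Coercivity bounds `p.1`, and then solving for `c • p.2` bounds `p.2`; hence the range is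
  -- closed.
  have hanti : ∃ K, AntilipschitzWith K L := by
    set K₁ := a⁻¹ with hK₁
    set K₂ := ‖c‖⁻¹ * (1 + ‖M‖ * a⁻¹) with hK₂
    have ha := hM.pos
    refine ⟨(K₁ + K₂).toNNReal, L.antilipschitz_of_bound fun p => ?_⟩
    rw [Real.coe_toNNReal _ (by positivity)]
    have h1 : ‖p.1.1‖ ≤ K₁ * ‖L p‖ := by
      have := hG.coercive_bound hM p.2 c
      rw [hK₁, inv_mul_eq_div, le_div_iff₀ ha, mul_comm]
      exact this
    have h2 : ‖p.1.2‖ ≤ K₂ * ‖L p‖ := by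
      have e : c • p.1.2 = L p - M p.1.1 := by rw [hL]; abel
      have h3 : ‖c‖ * ‖p.1.2‖ ≤ (1 + ‖M‖ * a⁻¹) * ‖L p‖ := by
        rw [← norm_smul, e]
        calc ‖L p - M p.1.1‖ ≤ ‖L p‖ + ‖M‖ * ‖p.1.1‖ :=
              (norm_sub_le _ _).trans (by gcongr; exact M.le_opNorm _)
          _ ≤ ‖L p‖ + ‖M‖ * (a⁻¹ * ‖L p‖) := by gcongr
          _ = _ := by ring
      rw [hK₂, mul_assoc, inv_mul_eq_div, le_div_iff₀ hc', mul_comm]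
      exact h3
    have h4 : ‖p‖ ≤ ‖p.1.1‖ + ‖p.1.2‖ := by
      change max ‖p.1.1‖ ‖p.1.2‖ ≤ _
      exact max_le_add_of_nonneg (norm_nonneg _) (norm_nonneg _)
    calc ‖p‖ ≤ _ := h4
      _ ≤ _ := add_le_add h1 h2
      _ = _ := by ring
  obtain ⟨K, hK⟩ := hanti
  have hcl : IsClosed (L.range : Set X) := hK.isClosed_range L.uniformContinuous
  have : CompleteSpace L.range := hcl.completeSpace_coe
  have htop : L.range = ⊤ := by
    rw [← Submodule.orthogonal_eq_bot_iff, Submodule.eq_bot_iff]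
    intro z hz
    -- Orthogonality of z to the range is the adjoint relation for this pair. Skewness then gives
    -- c⟪M z, z⟫ = 0, and z = 0 since c ≠ 0.
    have hmem : (c • z, M z) ∈ G := by
      refine (hG.mem_iff _ _).2 fun p hp => ?_
      have := (Submodule.mem_orthogonal _ z).1 hz (L ⟨p, hp⟩) ⟨⟨p, hp⟩, rfl⟩
      rw [hL, inner_add_left, inner_smul_left, hM.symm] at this
      rw [inner_smul_left, real_inner_comm, real_inner_comm p.1, add_comm]
      exact this
    have h0 := hG.inner_self hmem
    rw [inner_smul_right] at h0
    have h1 := hM.le z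
    rw [(mul_eq_zero.1 h0).resolve_left hc] at h1
    have h2 : ‖z‖ ^ 2 ≤ 0 := nonpos_of_mul_nonpos_right h1 hM.pos
    exact norm_eq_zero.1 (pow_eq_zero_iff two_ne_zero |>.1 (le_antisymm h2 (by positivity)))
  obtain ⟨p, hp⟩ : y ∈ L.range := htop ▸ Submodule.mem_top
  exact ⟨p.1, p.2, hp⟩

/-- The resolvent `(M + c B)⁻¹`. -/
theorem exists_resolvent [CompleteSpace X] (hG : IsSkewAdjointGraph G) (hM : IsCoerciveSymm M a) {c : ℝ}
    (hc : c ≠ 0) :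
    ∃ R : X →L[ℝ] X, (∀ y, ‖R y‖ ≤ a⁻¹ * ‖y‖) ∧
      (∀ y, ∃ v, (R y, v) ∈ G ∧ M (R y) + c • v = y) ∧
      ∀ p ∈ G, R (M p.1 + c • p.2) = p.1 := by
  choose S hSG hS using hG.exists_solution hM hc
  have huniq : ∀ p ∈ G, M p.1 + c • p.2 = 0 → p.1 = 0 := fun p hp h => by
    have := hG.coercive_bound hM hp c
    rw [h, norm_zero] at this
    exact norm_eq_zero.1 (le_antisymm (nonpos_of_mul_nonpos_right this hM.pos) (norm_nonneg _))
  have huniq' : ∀ p ∈ G, ∀ q ∈ G, M p.1 + c • p.2 = M q.1 + c • q.2 → p.1 = q.1 :=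
    fun p hp q hq h => by
    refine sub_eq_zero.1 (huniq (p - q) (G.sub_mem hp hq) ?_)
    rw [Prod.fst_sub, Prod.snd_sub, map_sub, smul_sub, sub_add_sub_comm, h, sub_self]
  let R₀ : X →ₗ[ℝ] X :=
    { toFun := fun y => (S y).1
      map_add' := fun x y => by
        refine huniq' _ (hSG _) (S x + S y) (G.add_mem (hSG x) (hSG y)) ?_
        rw [hS, Prod.fst_add, Prod.snd_add, map_add, smul_add, add_add_add_comm, hS, hS]
      map_smul' := fun r y => by
        refine huniq' _ (hSG _) (r • S y) (G.smul_mem r (hSG y)) ?_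
        rw [hS, Prod.smul_fst, Prod.smul_snd, map_smul, smul_comm c r, ← smul_add, hS] }
  have hb : ∀ y, ‖R₀ y‖ ≤ a⁻¹ * ‖y‖ := fun y => by
    have := hG.coercive_bound hM (hSG y) c
    rw [hS] at this
    rw [inv_mul_eq_div, le_div_iff₀ hM.pos, mul_comm]
    exact this
  exact ⟨R₀.mkContinuous a⁻¹ hb, hb, fun y => ⟨(S y).2, hSG y, hS y⟩,
    fun p hp => huniq' _ (hSG _) p hp (hS _)⟩

/-- The resolvents for `c` and `-c` are adjoint to each other. -/
theorem resolvent_adjoint (hG : IsSkewAdjointGraph G) (hM : IsCoerciveSymm M a) {c : ℝ}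
    {p q : X × X} (hp : p ∈ G) (hq : q ∈ G) :
    ⟪p.1, M q.1 + (-c) • q.2⟫_ℝ = ⟪M p.1 + c • p.2, q.1⟫_ℝ := by
  have := hG.skew hp hq
  rw [inner_add_right, inner_add_left, inner_smul_left, inner_smul_right, hM.symm]
  simp only [conj_trivial]
  linear_combination (-c) * this

end IsSkewAdjointGraph

/-- Coercivity makes M invertible (Lax–Milgram). The inverse will be the strong limit of the
resolvents as c tends to 0. -/
theorem IsCoerciveSymm.exists_right_inverse [CompleteSpace X] {M : X →L[ℝ] X} {a : ℝ}
    (hM : IsCoerciveSymm M a) : ∃ N : X →L[ℝ] X, ∀ y, M (N y) = y := by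
  have : IsUnit M := ContinuousLinearMap.isUnit_of_forall_le_norm_inner_map M
    (c := ⟨a, hM.pos.le⟩) hM.pos fun x => by
      rw [mul_comm]
      exact (hM.le x).trans (le_abs_self _)
  obtain ⟨u, rfl⟩ := this
  refine ⟨(↑u⁻¹ : X →L[ℝ] X), fun y => ?_⟩
  change ((u : X →L[ℝ] X) * (↑u⁻¹ : X →L[ℝ] X)) y = y
  rw [Units.mul_inv]
  rfl

end SkewAdjoint

/-! ### Weak evolution equations and their regularization. -/

section Evolution

open scoped InnerProductSpace
open Filter Topology

variable {X : Type*} [NormedAddCommGroup X] [InnerProductSpace ℝ X]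

/-- `w` is a weak solution on `]0,T[` of `(M w)' = B w - g`, `w(0) = w₀`, where `B` is the
skew-adjoint operator with graph `G`. -/
structure IsEvolutionSolution (G : Submodule ℝ (X × X)) (M : X →L[ℝ] X) (T : ℝ)
    (w g : ℝ → X) (w₀ : X) : Prop where
  memLp : MemLp w 2 (volume.restrict (Ioc 0 T))
  memLp_source : MemLp g 2 (volume.restrict (Ioc 0 T))
  weak : ∀ p ∈ G, ∀ ζ : ℝ → ℝ, ContDiff ℝ ∞ ζ → ζ T = 0 →
    ∫ t in Ioc 0 T, (-(deriv ζ t) * ⟪M (w t), p.1⟫_ℝ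
      + ζ t * (⟪w t, p.2⟫_ℝ + ⟪g t, p.1⟫_ℝ)) = ζ 0 * ⟪M w₀, p.1⟫_ℝ

theorem integrableOn_smul_of_continuous {f : ℝ → X} {ζ : ℝ → ℝ} {T : ℝ}
    (hf : IntegrableOn f (Ioc 0 T)) (hζ : Continuous ζ) :
    IntegrableOn (fun t => ζ t • f t) (Ioc 0 T) :=
  integrableOn_bilin_left (ContinuousLinearMap.lsmul ℝ ℝ).flip hf hζ.continuousOn

/-- A function orthogonal to the derivatives of all smooth functions vanishing at `T`
vanishes almost everywhere. -/
theorem ae_eq_zero_of_integral_deriv_smul [CompleteSpace X] {k : ℝ → X} {T : ℝ}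
    (hk : IntegrableOn k (Ioc 0 T))
    (h : ∀ ζ : ℝ → ℝ, ContDiff ℝ ∞ ζ → ζ T = 0 → ∫ t in Ioc 0 T, deriv ζ t • k t = 0) :
    ∀ᵐ t ∂(volume.restrict (Ioc 0 T)), k t = 0 := by
  rw [← restrict_Ioo_eq_restrict_Ioc, ae_restrict_iff' measurableSet_Ioo]
  refine isOpen_Ioo.ae_eq_zero_of_integral_contDiff_smul_eq_zero
    ((hk.mono_set Ioo_subset_Ioc_self).locallyIntegrableOn) fun ξ hξ _ hs => ?_
  -- Every test function ξ is the derivative of an admissible ζ: take the primitive based at T, so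
  -- that ζ(T) = 0.
  have hd : deriv (fun u => ∫ s in T..u, ξ s) = ξ :=
    funext fun t => hξ.continuous.deriv_integral ξ T t
  have hζ : ContDiff ℝ ∞ fun u => ∫ s in T..u, ξ s := by
    refine contDiff_infty_iff_deriv.2 ⟨fun t => ?_, by rwa [hd]⟩
    exact (hξ.continuous.integral_hasStrictDerivAt T t).hasDerivAt.differentiableAt
  have := h _ hζ intervalIntegral.integral_same
  rw [hd] at this
  rw [← this]
  symm
  refine setIntegral_eq_integral_of_forall_compl_eq_zero fun t ht => ?_
  rw [image_eq_zero_of_notMem_tsupport fun h' => ht (Ioo_subset_Ioc_self (hs h')), zero_smul]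

/-- Integration by parts of a smooth function against a primitive. -/
theorem integral_deriv_smul_primitive [CompleteSpace X] {f : ℝ → X} {ζ : ℝ → ℝ} {T : ℝ}
    (hT : 0 ≤ T) (hf : IntegrableOn f (Ioc 0 T)) (hζ : ContDiff ℝ ∞ ζ) (hζT : ζ T = 0) (u : X) :
    ∫ t in Ioc 0 T, deriv ζ t • (u - ∫ s in Ioc 0 t, f s)
      = (∫ t in Ioc 0 T, ζ t • f t) - ζ 0 • u := by
  have hd : Continuous (deriv ζ) := hζ.continuous_deriv (by simp)
  have hprim : ∀ t, 0 ≤ t → ζ 0 + ∫ s in Ioc 0 t, deriv ζ s = ζ t := fun t ht => by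
    rw [← intervalIntegral.integral_of_le ht, intervalIntegral.integral_deriv_eq_sub
      (fun x _ => (hζ.differentiable (by simp)).differentiableAt) (hd.intervalIntegrable _ _)]
    ring
  have := bilin_primitive_primitive (ContinuousLinearMap.lsmul ℝ ℝ : ℝ →L[ℝ] X →L[ℝ] X)
    (f := deriv ζ) (g := fun t => - f t) (t := T) hd.integrableOn_Ioc hf.neg (ζ 0) u
  rw [hprim T hT, hζT] at this
  simp only [ContinuousLinearMap.lsmul_apply, zero_smul, integral_neg, ← sub_eq_add_neg] at this
  have e : ∫ t in Ioc 0 T, (ζ 0 + ∫ s in Ioc 0 t, deriv ζ s) • (-f t)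
      = - ∫ t in Ioc 0 T, ζ t • f t := by
    rw [← integral_neg]
    refine setIntegral_congr_fun measurableSet_Ioc fun t ht => ?_
    rw [hprim t ht.1.le, smul_neg]
  rw [e] at this
  rw [eq_sub_iff_add_eq, ← sub_eq_zero, this]
  abel

section Regularization

variable {G : Submodule ℝ (X × X)} {M : X →L[ℝ] X} {a T : ℝ}
  {w g : ℝ → X} {w₀ : X}

theorem IsEvolutionSolution.integrableOn (h : IsEvolutionSolution G M T w g w₀) :
    IntegrableOn w (Ioc 0 T) := h.memLp.integrable (by norm_num)

theorem IsEvolutionSolution.integrableOn_source (h : IsEvolutionSolution G M T w g w₀) :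
    IntegrableOn g (Ioc 0 T) := h.memLp_source.integrable (by norm_num)

/-- For R = (M - c B)⁻¹ one has c R B = R M - 1, so the formal derivative R(B w - g) of R M w is
minus this integrand, in which only bounded operators occur. -/
theorem IsEvolutionSolution.integrableOn_rate [CompleteSpace X]
    (h : IsEvolutionSolution G M T w g w₀)
    (R : X →L[ℝ] X) (c : ℝ) :
    IntegrableOn (fun t => c⁻¹ • (w t - R (M (w t))) + R (g t)) (Ioc 0 T) :=
  ((h.integrableOn.sub ((R ∘L M).integrable_comp h.integrableOn)).smul c⁻¹).add
    (R.integrable_comp h.integrableOn_source)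

/-- The resolvent turns a weak solution into a primitive. -/
theorem IsEvolutionSolution.regularization [CompleteSpace X]
    (h : IsEvolutionSolution G M T w g w₀) (hT : 0 ≤ T)
    (hG : IsSkewAdjointGraph G) (hM : IsCoerciveSymm M a) {c : ℝ} (hc : c ≠ 0) {R : X →L[ℝ] X}
    (hR : ∀ y, ∃ v, (R y, v) ∈ G ∧ M (R y) + (-c) • v = y) :
    ∀ᵐ t ∂(volume.restrict (Ioc 0 T)),
      R (M w₀) - ∫ s in Ioc 0 t, (c⁻¹ • (w s - R (M (w s))) + R (g s)) = R (M (w t)) := by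
  set f : ℝ → X := fun s => c⁻¹ • (w s - R (M (w s))) + R (g s) with hfdef
  have hf : IntegrableOn f (Ioc 0 T) := h.integrableOn_rate R c
  have hJ : IntegrableOn (fun t => R (M (w t))) (Ioc 0 T) :=
    (R ∘L M).integrable_comp h.integrableOn
  have hV : IntegrableOn (fun t => R (M w₀) - ∫ s in Ioc 0 t, f s) (Ioc 0 T) :=
    ((continuousOn_const.sub (continuousOn_primitive_Ioc hf)).integrableOn_Icc).mono_set
      Ioc_subset_Icc_self
  -- The weak form of (R M w)' = -f with initial value R M w₀.
  have key : ∀ ζ : ℝ → ℝ, ContDiff ℝ ∞ ζ → ζ T = 0 →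
      ∫ t in Ioc 0 T, (-(deriv ζ t) • R (M (w t)) + ζ t • f t) = ζ 0 • R (M w₀) := by
    intro ζ hζ hζT
    have hd : Continuous (deriv ζ) := hζ.continuous_deriv (by simp)
    have hint : IntegrableOn (fun t => -(deriv ζ t) • R (M (w t)) + ζ t • f t) (Ioc 0 T) :=
      (integrableOn_smul_of_continuous hJ hd.neg).add
        (integrableOn_smul_of_continuous hf hζ.continuous)
    refine ext_inner_left ℝ fun y => ?_
    obtain ⟨N, hN⟩ := hM.exists_right_inverse
    -- With y = (M + c B)p, the adjoint of R sends y to p. Pairing with y therefore amounts to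
    -- testing the equation with p, which lies in the domain.
    obtain ⟨p, hp, hpy⟩ := hG.exists_solution hM hc y
    have hadj : ∀ z, ⟪M p.1 + c • p.2, R z⟫_ℝ = ⟪p.1, z⟫_ℝ := fun z => by
      obtain ⟨v, hv, hz⟩ := hR z
      have := hG.resolvent_adjoint hM (c := c) hp hv
      rw [hz] at this
      exact this.symm
    have hw := h.weak p hp ζ hζ hζT
    rw [← integral_inner hint, inner_smul_right, ← hpy, hadj, real_inner_comm, ← hw]
    refine integral_congr_ae (Eventually.of_forall fun t => ?_)
    simp only [hfdef]
    have e1 : ⟪M p.1 + c • p.2, w t⟫_ℝ = ⟪M (w t), p.1⟫_ℝ + c * ⟪w t, p.2⟫_ℝ := by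
      rw [inner_add_left, inner_smul_left, hM.symm, real_inner_comm, real_inner_comm p.2]
      simp only [conj_trivial]
    rw [inner_add_right, inner_smul_right, inner_smul_right, inner_add_right, inner_smul_right,
      inner_sub_right, hadj, hadj, e1, real_inner_comm p.1, real_inner_comm (g t)]
    field_simp
    ring
  -- R M w and the primitive have equal integrals against every ζ'. As ζ(0) is free, not even a
  -- constant can separate them.
  have := ae_eq_zero_of_integral_deriv_smul (hJ.sub hV) fun ζ hζ hζT => by
    have hd : Continuous (deriv ζ) := hζ.continuous_deriv (by simp)
    have h1 := key ζ hζ hζT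
    have h2 := integral_deriv_smul_primitive hT hf hζ hζT (R (M w₀))
    simp only [neg_smul] at h1
    have hJd : IntegrableOn (fun t => -(deriv ζ t • R (M (w t)))) (Ioc 0 T) :=
      (integrableOn_smul_of_continuous hJ hd).neg
    rw [integral_add hJd (integrableOn_smul_of_continuous hf hζ.continuous), integral_neg] at h1
    simp only [Pi.sub_apply, smul_sub]
    simp only [smul_sub] at h2
    rw [integral_sub (integrableOn_smul_of_continuous hJ hd) (by
      simpa only [smul_sub, IntegrableOn] using integrableOn_smul_of_continuous hV hd), h2, ← h1]
    abel
  filter_upwards [this] with t ht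
  exact (sub_eq_zero.1 ht).symm

/-- Energy identity for a primitive which is almost everywhere in the domain. -/
theorem energy_identity_of_domain [CompleteSpace X] (hG : IsSkewAdjointGraph G) (hM : IsCoerciveSymm M a)
    {f y q : ℝ → X} {v₀ : X} (hf : IntegrableOn f (Ioc 0 T))
    (hy : ∀ᵐ t ∂(volume.restrict (Ioc 0 T)), v₀ - ∫ s in Ioc 0 t, f s = y t)
    (hn : ∀ᵐ t ∂(volume.restrict (Ioc 0 T)), ∃ n, (y t, n) ∈ G ∧ M (f t) = M (q t) - n)
    {t : ℝ} (ht : t ≤ T) :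
    ⟪M (v₀ - ∫ s in Ioc 0 t, f s), v₀ - ∫ s in Ioc 0 t, f s⟫_ℝ
      = ⟪M v₀, v₀⟫_ℝ - 2 * ∫ s in Ioc 0 t, ⟪M (q s), y s⟫_ℝ := by
  have hsub : Ioc 0 t ⊆ Ioc 0 T := Ioc_subset_Ioc_right ht
  have hft := (hf.mono_set hsub).neg
  have := bilin_primitive_primitive ((innerSL ℝ).comp M : X →L[ℝ] X →L[ℝ] ℝ)
    (f := fun t => - f t) (g := fun t => - f t) (t := t) hft hft v₀ v₀
  simp only [ContinuousLinearMap.comp_apply, integral_neg, ← sub_eq_add_neg,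
    innerSL_apply_apply] at this
  rw [this, add_assoc, sub_eq_add_neg]
  congr 1
  have e1 : ∫ s in Ioc 0 t, ⟪M (-f s), v₀ - ∫ r in Ioc 0 s, f r⟫_ℝ
      = - ∫ s in Ioc 0 t, ⟪M (q s), y s⟫_ℝ := by
    rw [← integral_neg]
    refine integral_congr_ae ?_
    filter_upwards [ae_restrict_of_ae_restrict_of_subset hsub hy,
      ae_restrict_of_ae_restrict_of_subset hsub hn] with s hs hs'
    obtain ⟨n, hn, hn'⟩ := hs'
    -- The term n = B y drops out because B is skew.
    rw [hs, map_neg, hn', inner_neg_left, inner_sub_left, hG.inner_self hn, sub_zero]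
  have e2 : ∫ s in Ioc 0 t, ⟪M (v₀ - ∫ r in Ioc 0 s, f r), -f s⟫_ℝ
      = - ∫ s in Ioc 0 t, ⟪M (q s), y s⟫_ℝ := by
    rw [← e1]
    refine integral_congr_ae (Eventually.of_forall fun s => ?_)
    simp only
    rw [hM.symm, real_inner_comm]
  rw [e1, e2]
  ring

end Regularization

end Evolution

/-! ### Removing the regularization. -/

section Limit

open scoped InnerProductSpace
open Filter Topology

variable {X : Type*} [NormedAddCommGroup X] [InnerProductSpace ℝ X]

/-- The bound does not depend on t, so the sequence is uniformly Cauchy. The form `γ n + γ k` suits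
the energy estimate, whose errors separate in the two indices. -/
theorem exists_continuousOn_limit {Y : Type*} [NormedAddCommGroup Y] [CompleteSpace Y]
    {V : ℕ → ℝ → Y} {s : Set ℝ} {γ : ℕ → ℝ}
    (hV : ∀ n, ContinuousOn (V n) s) (hγ : Tendsto γ atTop (𝓝 0))
    (hC : ∀ n k, ∀ t ∈ s, ‖V n t - V k t‖ ^ 2 ≤ γ n + γ k) :
    ∃ W : ℝ → Y, ContinuousOn W s ∧ ∀ t ∈ s, Tendsto (fun n => V n t) atTop (𝓝 (W t)) := by
  have hU : UniformCauchySeqOn V atTop s := by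
    rw [Metric.uniformCauchySeqOn_iff]
    intro r hr
    obtain ⟨N, hN⟩ := (Metric.tendsto_atTop.1 hγ) (r ^ 2 / 2) (by positivity)
    refine ⟨N, fun m hm n hn t ht => ?_⟩
    have h1 := hN m hm
    have h2 := hN n hn
    rw [Real.dist_eq, sub_zero] at h1 h2
    have h3 := hC m n t ht
    rw [dist_eq_norm]
    refine lt_of_pow_lt_pow_left₀ 2 hr.le ?_
    linarith [le_abs_self (γ m), le_abs_self (γ n)]
  have hlim : ∀ t ∈ s, ∃ x, Tendsto (fun n => V n t) atTop (𝓝 x) := fun t ht =>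
    cauchySeq_tendsto_of_complete (hU.cauchySeq ht)
  choose! W hW using hlim
  exact ⟨W, (hU.tendstoUniformlyOn_of_tendsto hW).continuousOn
    (Frequently.of_forall hV), hW⟩

variable {G : Submodule ℝ (X × X)} {M : X →L[ℝ] X} {a T : ℝ}
  {w g : ℝ → X} {w₀ : X}

/-- The resolvents of a skew-adjoint operator converge strongly to the identity. -/
theorem tendsto_resolvent [CompleteSpace X] (hG : IsSkewAdjointGraph G)
    (hM : IsCoerciveSymm M a) {c : ℕ → ℝ} (hc : Tendsto c atTop (𝓝 0)) {R : ℕ → X →L[ℝ] X}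
    (hb : ∀ n y, ‖R n y‖ ≤ a⁻¹ * ‖y‖)
    (hR : ∀ n, ∀ p ∈ G, R n (M p.1 + c n • p.2) = p.1) (u : X) :
    Tendsto (fun n => R n (M u)) atTop (𝓝 u) := by
  have ha := hM.pos
  rw [Metric.tendsto_atTop]
  intro r hr
  set K := 1 + a⁻¹ * ‖M‖ with hK
  have hK0 : 0 < K := by positivity
  -- On the domain, R M p = p - c R B p tends to p. The constant `K` bounds the norm of R M - 1,
  -- which carries the convergence over to all u by density.
  obtain ⟨p, hp, hup⟩ := hG.dense_domain u (r := r / (2 * K)) (by positivity)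
  have hc' : Tendsto (fun n => a⁻¹ * (|c n| * ‖p.2‖)) atTop (𝓝 0) := by
    have := ((hc.abs).mul_const ‖p.2‖).const_mul a⁻¹
    simpa using this
  obtain ⟨N, hN⟩ := (Metric.tendsto_atTop.1 hc') (r / 2) (by positivity)
  refine ⟨N, fun n hn => ?_⟩
  have h1 : R n (M u) - u = R n (M (u - p.1)) - (u - p.1) - R n (c n • p.2) := by
    have := hR n p hp
    rw [map_add] at this
    rw [map_sub, map_sub, eq_sub_of_add_eq' this]
    abel
  have h2 : ‖R n (M (u - p.1)) - (u - p.1)‖ ≤ K * ‖u - p.1‖ := by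
    calc _ ≤ ‖R n (M (u - p.1))‖ + ‖u - p.1‖ := norm_sub_le _ _
      _ ≤ a⁻¹ * (‖M‖ * ‖u - p.1‖) + ‖u - p.1‖ := by
        gcongr
        exact (hb n _).trans (by gcongr; exact M.le_opNorm _)
      _ = _ := by rw [hK]; ring
  have h3 : ‖R n (c n • p.2)‖ ≤ a⁻¹ * (|c n| * ‖p.2‖) :=
    (hb n _).trans_eq (by rw [norm_smul, Real.norm_eq_abs])
  have h4 := hN n hn
  rw [Real.dist_eq, sub_zero] at h4
  have h5 : K * ‖u - p.1‖ < r / 2 := by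
    calc _ < K * (r / (2 * K)) := by gcongr
      _ = r / 2 := by field_simp
  rw [dist_eq_norm, h1]
  calc _ ≤ _ := norm_sub_le _ _
    _ < r := by linarith [le_abs_self (a⁻¹ * (|c n| * ‖p.2‖))]

/-- Weak solutions of a skew-adjoint evolution equation are continuous in time, attain their
initial value, and satisfy the energy identity. -/
theorem IsEvolutionSolution.exists_continuous [CompleteSpace X]
    (h : IsEvolutionSolution G M T w g w₀) (hT : 0 ≤ T)
    (hG : IsSkewAdjointGraph G) (hM : IsCoerciveSymm M a) :
    ∃ W : ℝ → X, ContinuousOn W (Icc 0 T) ∧ (∀ᵐ t ∂(volume.restrict (Ioc 0 T)), W t = w t) ∧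
      W 0 = w₀ ∧ ∀ t ∈ Icc 0 T, ⟪M (W t), W t⟫_ℝ
        = ⟪M w₀, w₀⟫_ℝ - 2 * ∫ s in Ioc 0 t, ⟪g s, w s⟫_ℝ := by
  have ha := hM.pos
  -- Any nonzero sequence tending to 0 would do; the resolvents used are (M - c B)⁻¹.
  set c : ℕ → ℝ := fun n => 1 / ((n : ℝ) + 1) with hcdef
  have hc0 : ∀ n, c n ≠ 0 := fun n => (Nat.one_div_pos_of_nat).ne'
  have hclim : Tendsto (fun n => -c n) atTop (𝓝 0) := by
    simpa [hcdef] using (tendsto_one_div_add_atTop_nhds_zero_nat (𝕜 := ℝ)).neg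
  choose R hb hR hR' using fun n => hG.exists_resolvent hM (neg_ne_zero.2 (hc0 n))
  have hlim : ∀ u, Tendsto (fun n => R n (M u)) atTop (𝓝 u) :=
    tendsto_resolvent hG hM hclim hb hR'
  obtain ⟨N, hN⟩ := hM.exists_right_inverse
  -- Writing y = M N y gives strong convergence of the resolvents to M⁻¹ = N.
  have hlim' : ∀ y, Tendsto (fun n => R n y) atTop (𝓝 (N y)) := fun y => by
    have := hlim (N y)
    rwa [hN] at this
  set f : ℕ → ℝ → X := fun n s => (c n)⁻¹ • (w s - R n (M (w s))) + R n (g s) with hfdef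
  set V : ℕ → ℝ → X := fun n t => R n (M w₀) - ∫ s in Ioc 0 t, f n s with hVdef
  have hf : ∀ n, IntegrableOn (f n) (Ioc 0 T) := fun n => h.integrableOn_rate (R n) (c n)
  have hVw : ∀ n, ∀ᵐ t ∂(volume.restrict (Ioc 0 T)), V n t = R n (M (w t)) := fun n =>
    h.regularization hT hG hM (hc0 n) (hR n)
  have hgraph : ∀ n t, ∃ z, (R n (M (w t)), z) ∈ G ∧ M (f n t) = M (R n (g t)) - z := by
    intro n t
    obtain ⟨v, hv, hz⟩ := hR n (M (w t))
    refine ⟨v, hv, ?_⟩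
    have e : M (w t) - M (R n (M (w t))) = -(c n • v) := by
      nth_rewrite 1 [← hz]
      rw [neg_smul]
      abel
    simp only [hfdef, map_add, map_smul, map_sub]
    rw [e, smul_neg, smul_smul, inv_mul_cancel₀ (hc0 n), one_smul]
    abel
  have hw2 := h.memLp
  have hg2 := h.memLp_source
  have hgw : Integrable (fun t => ‖g t‖ * ‖w t‖) (volume.restrict (Ioc 0 T)) :=
    (hg2.norm).integrable_mul hw2.norm
  have hRgm : ∀ n, AEStronglyMeasurable (fun t => R n (g t)) (volume.restrict (Ioc 0 T)) :=
    fun n => (R n).continuous.comp_aestronglyMeasurable hg2.1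
  have hNgm : AEStronglyMeasurable (fun t => N (g t)) (volume.restrict (Ioc 0 T)) :=
    N.continuous.comp_aestronglyMeasurable hg2.1
  have hbm : ∀ n, AEStronglyMeasurable (fun t => ‖R n (g t) - N (g t)‖ * ‖w t‖)
      (volume.restrict (Ioc 0 T)) := fun n => ((hRgm n).sub hNgm).norm.mul hw2.1.norm
  have hbb : ∀ n t, ‖R n (g t) - N (g t)‖ * ‖w t‖ ≤ (a⁻¹ + ‖N‖) * (‖g t‖ * ‖w t‖) :=
    fun n t => by
    have : ‖R n (g t) - N (g t)‖ ≤ (a⁻¹ + ‖N‖) * ‖g t‖ := by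
      rw [add_mul]
      exact (norm_sub_le _ _).trans (add_le_add (hb n _) (N.le_opNorm _))
    rw [← mul_assoc]
    gcongr
  have hbint : ∀ n, Integrable (fun t => ‖R n (g t) - N (g t)‖ * ‖w t‖)
      (volume.restrict (Ioc 0 T)) := fun n =>
    (hgw.const_mul (a⁻¹ + ‖N‖)).mono' (hbm n) (Eventually.of_forall fun t => by
      rw [Real.norm_of_nonneg (by positivity)]
      exact hbb n t)
  have hβ : Tendsto (fun n => ∫ t in Ioc 0 T, ‖R n (g t) - N (g t)‖ * ‖w t‖) atTop (𝓝 0) := by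
    have : Tendsto (fun n => ∫ t in Ioc 0 T, ‖R n (g t) - N (g t)‖ * ‖w t‖) atTop
        (𝓝 (∫ t in Ioc 0 T, (0 : ℝ))) := by
      refine tendsto_integral_of_dominated_convergence _ hbm (hgw.const_mul (a⁻¹ + ‖N‖))
        (fun n => Eventually.of_forall fun t => ?_) (Eventually.of_forall fun t => ?_)
      · rw [Real.norm_of_nonneg (by positivity)]
        exact hbb n t
      · have := ((tendsto_iff_norm_sub_tendsto_zero.1 (hlim' (g t))).mul_const ‖w t‖)
        rwa [zero_mul] at this
    rwa [integral_zero] at this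
  set β : ℕ → ℝ := fun n => ∫ t in Ioc 0 T, ‖R n (g t) - N (g t)‖ * ‖w t‖ with hβdef
  set δ : ℕ → ℝ := fun n => ‖R n (M w₀) - w₀‖ with hδdef
  have hδ : Tendsto δ atTop (𝓝 0) := tendsto_iff_norm_sub_tendsto_zero.1 (hlim w₀)
  set C : ℝ := 2 * (‖M‖ * (2 * (a⁻¹ * ‖M‖))) with hCdef
  -- The energy identity for the difference of two regularizations. The factor 2 in `C` comes from
  -- that identity, the rest from bounding R M w by a⁻¹‖M‖‖w‖ twice. The source differences are
  -- compared through N, so the errors separate in n and k.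
  have hdiff : ∀ n k, ∀ t ∈ Icc 0 T, a * ‖V n t - V k t‖ ^ 2
      ≤ ‖M‖ * (δ n + δ k) ^ 2 + C * (β n + β k) := by
    intro n k t ht
    have hsub : Ioc 0 t ⊆ Ioc 0 T := Ioc_subset_Ioc_right ht.2
    have hVsub : ∀ s ∈ Icc 0 T, V n s - V k s
        = (R n (M w₀) - R k (M w₀)) - ∫ r in Ioc 0 s, (f n r - f k r) := fun s hs => by
      have hs' : Ioc 0 s ⊆ Ioc 0 T := Ioc_subset_Ioc_right hs.2
      rw [integral_sub ((hf n).mono_set hs') ((hf k).mono_set hs')]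
      simp only [hVdef]
      abel
    have hen := energy_identity_of_domain hG hM (v₀ := R n (M w₀) - R k (M w₀))
      (f := fun r => f n r - f k r) (y := fun r => R n (M (w r)) - R k (M (w r)))
      (q := fun r => R n (g r) - R k (g r)) ((hf n).sub (hf k))
      (by
        filter_upwards [hVw n, hVw k, ae_restrict_mem measurableSet_Ioc] with s hs1 hs2 hs
        rw [← hVsub s (Ioc_subset_Icc_self hs), hs1, hs2])
      (Eventually.of_forall fun s => by
        obtain ⟨z, hz, ez⟩ := hgraph n s
        obtain ⟨z', hz', ez'⟩ := hgraph k s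
        refine ⟨z - z', G.sub_mem hz hz', ?_⟩
        rw [map_sub, ez, ez', map_sub]
        abel) ht.2
    rw [← hVsub t ht] at hen
    have h1 := hM.le (V n t - V k t)
    have h2 : ⟪M (R n (M w₀) - R k (M w₀)), R n (M w₀) - R k (M w₀)⟫_ℝ
        ≤ ‖M‖ * (δ n + δ k) ^ 2 := by
      have e : ‖R n (M w₀) - R k (M w₀)‖ ≤ δ n + δ k := by
        have := norm_sub_le (R n (M w₀) - w₀) (R k (M w₀) - w₀)
        rwa [sub_sub_sub_cancel_right] at this
      calc _ ≤ ‖M (R n (M w₀) - R k (M w₀))‖ * ‖R n (M w₀) - R k (M w₀)‖ :=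
            real_inner_le_norm _ _
        _ ≤ ‖M‖ * ‖R n (M w₀) - R k (M w₀)‖ * ‖R n (M w₀) - R k (M w₀)‖ := by
            gcongr
            exact M.le_opNorm _
        _ ≤ ‖M‖ * (δ n + δ k) * (δ n + δ k) := by gcongr
        _ = _ := by ring
    have h3 : |∫ s in Ioc 0 t, ⟪M (R n (g s) - R k (g s)), R n (M (w s)) - R k (M (w s))⟫_ℝ|
        ≤ C / 2 * (β n + β k) := by
      rw [← Real.norm_eq_abs]
      have hbi : Integrable (fun s => C / 2 * (‖R n (g s) - N (g s)‖ * ‖w s‖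
          + ‖R k (g s) - N (g s)‖ * ‖w s‖)) (volume.restrict (Ioc 0 T)) :=
        ((hbint n).add (hbint k)).const_mul _
      calc _ ≤ ∫ s in Ioc 0 t, C / 2 * (‖R n (g s) - N (g s)‖ * ‖w s‖
              + ‖R k (g s) - N (g s)‖ * ‖w s‖) := by
            refine norm_integral_le_of_norm_le (IntegrableOn.mono_set hbi hsub)
              (Eventually.of_forall fun s => ?_)
            have e1 : ‖R n (g s) - R k (g s)‖
                ≤ ‖R n (g s) - N (g s)‖ + ‖R k (g s) - N (g s)‖ := by
              have := norm_sub_le (R n (g s) - N (g s)) (R k (g s) - N (g s))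
              rwa [sub_sub_sub_cancel_right] at this
            have e3 : ∀ m, ‖R m (M (w s))‖ ≤ a⁻¹ * ‖M‖ * ‖w s‖ := fun m => by
              rw [mul_assoc]
              exact (hb m _).trans (by gcongr; exact M.le_opNorm _)
            have e2 : ‖R n (M (w s)) - R k (M (w s))‖ ≤ 2 * (a⁻¹ * ‖M‖) * ‖w s‖ := by
              linarith [norm_sub_le (R n (M (w s))) (R k (M (w s))), e3 n, e3 k]
            calc _ ≤ ‖M (R n (g s) - R k (g s))‖ * ‖R n (M (w s)) - R k (M (w s))‖ :=
                  norm_inner_le_norm _ _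
              _ ≤ ‖M‖ * ‖R n (g s) - R k (g s)‖ * ‖R n (M (w s)) - R k (M (w s))‖ := by
                  gcongr
                  exact M.le_opNorm _
              _ ≤ ‖M‖ * (‖R n (g s) - N (g s)‖ + ‖R k (g s) - N (g s)‖)
                  * (2 * (a⁻¹ * ‖M‖) * ‖w s‖) := by gcongr
              _ = _ := by rw [hCdef]; ring
        _ ≤ ∫ s in Ioc 0 T, C / 2 * (‖R n (g s) - N (g s)‖ * ‖w s‖
              + ‖R k (g s) - N (g s)‖ * ‖w s‖) := by
            refine setIntegral_mono_set hbi (Eventually.of_forall fun s => ?_)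
              (Eventually.of_forall hsub)
            change 0 ≤ _
            positivity
        _ = C / 2 * (β n + β k) := by
            rw [integral_const_mul, integral_add (hbint n) (hbint k)]
    rw [hen] at h1
    have h4 := (abs_le.1 h3).1
    linarith
  have hVc : ∀ n, ContinuousOn (V n) (Icc 0 T) := fun n =>
    continuousOn_const.sub (continuousOn_primitive_Ioc (hf n))
  obtain ⟨W, hWc, hW⟩ := exists_continuousOn_limit hVc
    (γ := fun n => a⁻¹ * (2 * ‖M‖ * δ n ^ 2 + C * β n))
    (by
      have := (((hδ.pow 2).const_mul (2 * ‖M‖)).add (hβ.const_mul C)).const_mul a⁻¹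
      simpa using this)
    (fun n k t ht => by
      have h1 := hdiff n k t ht
      have h2 : ‖M‖ * (δ n + δ k) ^ 2 ≤ 2 * ‖M‖ * δ n ^ 2 + 2 * ‖M‖ * δ k ^ 2 := by
        nlinarith [mul_nonneg (norm_nonneg M) (sq_nonneg (δ n - δ k))]
      rw [← mul_add, inv_mul_eq_div, le_div_iff₀ ha, mul_comm]
      linarith)
  have hWw : ∀ᵐ t ∂(volume.restrict (Ioc 0 T)), W t = w t := by
    -- The exceptional sets are countable in number, so off one null set all regularizations equal R
    -- M w, which tends to w.
    filter_upwards [ae_all_iff.2 hVw, ae_restrict_mem measurableSet_Ioc] with t ht htI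
    refine tendsto_nhds_unique (hW t (Ioc_subset_Icc_self htI)) ?_
    simp_rw [ht]
    exact hlim (w t)
  refine ⟨W, hWc, hWw, ?_, fun t ht => ?_⟩
  · refine tendsto_nhds_unique (hW 0 (left_mem_Icc.2 hT)) ?_
    simp only [hVdef, Ioc_self, setIntegral_empty, sub_zero]
    exact hlim w₀
  · have hsub : Ioc 0 t ⊆ Ioc 0 T := Ioc_subset_Ioc_right ht.2
    have hen := fun n => energy_identity_of_domain hG hM (v₀ := R n (M w₀)) (hf n)
      (q := fun r => R n (g r)) (hVw n) (Eventually.of_forall (hgraph n)) ht.2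
    have hquad : ∀ {x : ℕ → X} {z : X}, Tendsto x atTop (𝓝 z) →
        Tendsto (fun n => ⟪M (x n), x n⟫_ℝ) atTop (𝓝 ⟪M z, z⟫_ℝ) := fun hx =>
      ((M.continuous.tendsto _).comp hx).inner hx
    refine tendsto_nhds_unique (hquad (hW t ht)) ?_
    -- Since M N = 1, the limit integrand is ⟪g, w⟫; the uniform resolvent bound supplies the
    -- majorant.
    have : Tendsto (fun n => ∫ s in Ioc 0 t, ⟪M (R n (g s)), R n (M (w s))⟫_ℝ) atTop
        (𝓝 (∫ s in Ioc 0 t, ⟪g s, w s⟫_ℝ)) := by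
      refine tendsto_integral_of_dominated_convergence
        (fun s => ‖M‖ * a⁻¹ * (a⁻¹ * ‖M‖) * (‖g s‖ * ‖w s‖)) (fun n => ?_)
        (IntegrableOn.mono_set (hgw.const_mul _) hsub)
        (fun n => Eventually.of_forall fun s => ?_) (Eventually.of_forall fun s => ?_)
      · refine AEStronglyMeasurable.mono_set hsub (AEStronglyMeasurable.inner
          (M.continuous.comp_aestronglyMeasurable (hRgm n)) ?_)
        exact (R n ∘L M).continuous.comp_aestronglyMeasurable hw2.1
      · calc _ ≤ ‖M (R n (g s))‖ * ‖R n (M (w s))‖ := norm_inner_le_norm _ _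
          _ ≤ (‖M‖ * (a⁻¹ * ‖g s‖)) * (a⁻¹ * (‖M‖ * ‖w s‖)) := by
            gcongr
            · exact (M.le_opNorm _).trans (by gcongr; exact hb n _)
            · exact (hb n _).trans (by gcongr; exact M.le_opNorm _)
          _ = _ := by ring
      · have h1 := (M.continuous.tendsto _).comp (hlim' (g s))
        rw [hN] at h1
        exact h1.inner (hlim (w s))
    have h2 := (hquad (hlim w₀)).sub (this.const_mul 2)
    refine h2.congr fun n => ?_
    rw [← hen n]

end Limit

/-! ### Square integrable functions on a product as L²-valued functions of time. -/

noncomputable section Slices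

open scoped ENNReal

/-- In a separable metric space an open set is a countable union of balls, whose preimages are
sublevel sets of distance functions. -/
theorem measurable_of_edist {α Y : Type*} [MeasurableSpace α] [MetricSpace Y]
    [SecondCountableTopology Y] [MeasurableSpace Y] [BorelSpace Y] {F : α → Y}
    (hF : ∀ y, Measurable fun t => edist (F t) y) : Measurable F := by
  refine measurable_of_isOpen fun U hU => ?_
  choose! r hr using fun y (hy : y ∈ U) => EMetric.isOpen_iff.1 hU y hy
  obtain ⟨S, hSU, hS, hS'⟩ := TopologicalSpace.isOpen_biUnion_countable U
    (fun y => Metric.eball y (r y)) fun y _ => Metric.isOpen_eball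
  have hU' : U = ⋃ y ∈ S, Metric.eball y (r y) := by
    rw [hS']
    refine Subset.antisymm (fun y hy => mem_biUnion hy (Metric.mem_eball_self (hr y hy).1))
      (iUnion₂_subset fun y hy => (hr y hy).2)
  rw [hU', preimage_iUnion₂]
  exact MeasurableSet.biUnion hS fun y _ => measurableSet_lt (hF y) measurable_const

variable {α E : Type*} [MeasurableSpace α] [NormedAddCommGroup E]

open Classical in
/-- The slice `f(·,t)` of `f`, as an element of `L²`. -/
def slice (μ : Measure α) (f : α × ℝ → E) (t : ℝ) : Lp E 2 μ :=
  if h : MemLp (fun x => f (x, t)) 2 μ then h.toLp else 0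

theorem slice_of_memLp {μ : Measure α} {f : α × ℝ → E} {t : ℝ}
    (h : MemLp (fun x => f (x, t)) 2 μ) : slice μ f t = h.toLp := dif_pos h

theorem slice_of_not_memLp {μ : Measure α} {f : α × ℝ → E} {t : ℝ}
    (h : ¬ MemLp (fun x => f (x, t)) 2 μ) : slice μ f t = 0 := dif_neg h

variable {μ : Measure α} {ν : Measure ℝ} [SFinite μ] [SFinite ν] {f g : α × ℝ → E}

theorem ae_ae_of_ae_prod_right {p : α × ℝ → Prop} (h : ∀ᵐ z ∂(μ.prod ν), p z) :
    ∀ᵐ t ∂ν, ∀ᵐ x ∂μ, p (x, t) :=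
  Measure.ae_ae_of_ae_prod
    ((Measure.measurePreserving_swap (μ := ν) (ν := μ)).quasiMeasurePreserving.ae h)

theorem lintegral_enorm_sq_lt_top (hf : MemLp f 2 (μ.prod ν)) :
    ∫⁻ t, ∫⁻ x, ‖f (x, t)‖ₑ ^ (2 : ℝ) ∂μ ∂ν < ⊤ := by
  have := (eLpNorm_lt_top_iff_lintegral_rpow_enorm_lt_top two_ne_zero ENNReal.ofNat_ne_top).1 hf.2
  rwa [lintegral_prod_symm _ (hf.1.enorm.pow_const _)] at this

theorem ae_memLp_slice (hf : MemLp f 2 (μ.prod ν)) :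
    ∀ᵐ t ∂ν, MemLp (fun x => f (x, t)) 2 μ := by
  have hm : AEMeasurable (fun t => ∫⁻ x, ‖f (x, t)‖ₑ ^ (2 : ℝ) ∂μ) ν := by
    have h1 : AEMeasurable (fun z : ℝ × α => ‖f z.swap‖ₑ ^ (2 : ℝ)) (ν.prod μ) :=
      hf.1.prod_swap.enorm.pow_const _
    exact h1.lintegral_prod_right'
  filter_upwards [hf.1.prodMk_right, ae_lt_top' hm (lintegral_enorm_sq_lt_top hf).ne]
    with t h1 h2
  exact ⟨h1, (eLpNorm_lt_top_iff_lintegral_rpow_enorm_lt_top two_ne_zero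
    ENNReal.ofNat_ne_top).2 h2⟩

theorem coeFn_slice (hf : MemLp f 2 (μ.prod ν)) :
    ∀ᵐ t ∂ν, ∀ᵐ x ∂μ, slice μ f t x = f (x, t) := by
  filter_upwards [ae_memLp_slice hf] with t ht
  rw [slice_of_memLp ht]
  exact ht.coeFn_toLp

theorem slice_congr (h : f =ᵐ[μ.prod ν] g) : slice μ f =ᵐ[ν] slice μ g := by
  filter_upwards [ae_ae_of_ae_prod_right h] with t ht
  have : MemLp (fun x => f (x, t)) 2 μ ↔ MemLp (fun x => g (x, t)) 2 μ := memLp_congr_ae ht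
  by_cases h1 : MemLp (fun x => f (x, t)) 2 μ
  · rw [slice_of_memLp h1, slice_of_memLp (this.1 h1)]
    exact MemLp.toLp_congr _ _ ht
  · rw [slice_of_not_memLp h1, slice_of_not_memLp (this.not.1 h1)]

theorem aestronglyMeasurable_slice [SecondCountableTopology E] [IsSeparable μ]
    [MeasurableSpace E] [BorelSpace E]
    (hf : AEStronglyMeasurable f (μ.prod ν)) : AEStronglyMeasurable (slice μ f) ν := by
  suffices h : ∀ g : α × ℝ → E, StronglyMeasurable g → AEStronglyMeasurable (slice μ g) ν from
    (h _ hf.stronglyMeasurable_mk).congr (slice_congr hf.ae_eq_mk).symm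
  intro g hg
  -- Finiteness of the exponent makes L² separable, as `measurable_of_edist` requires.
  have : Fact ((2 : ℝ≥0∞) ≠ ⊤) := ⟨ENNReal.ofNat_ne_top⟩
  classical
  borelize ↥(Lp E 2 μ)
  have hgm : Measurable g := hg.measurable
  have hrep : ∀ t, AEStronglyMeasurable (fun x => g (x, t)) μ := fun t =>
    (hg.comp_measurable measurable_prodMk_right).aestronglyMeasurable
  have hS : MeasurableSet {t | MemLp (fun x => g (x, t)) 2 μ} := by
    have : {t | MemLp (fun x => g (x, t)) 2 μ}
        = {t | ∫⁻ x, ‖g (x, t)‖ₑ ^ (2 : ℝ) ∂μ < ⊤} := by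
      ext t
      exact ⟨fun h => (eLpNorm_lt_top_iff_lintegral_rpow_enorm_lt_top two_ne_zero
          ENNReal.ofNat_ne_top).1 h.2,
        fun h => ⟨hrep t, (eLpNorm_lt_top_iff_lintegral_rpow_enorm_lt_top two_ne_zero
          ENNReal.ofNat_ne_top).2 h⟩⟩
    rw [this]
    exact measurableSet_lt (Measurable.lintegral_prod_left' (hgm.enorm.pow_const _))
      measurable_const
  refine (measurable_of_edist fun v => ?_).aestronglyMeasurable
  have hv : Measurable (v : α → E) := (Lp.stronglyMeasurable v).measurable
  -- The distance to v is a parameter integral, measurable by Tonelli, where the slice is square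
  -- integrable. Elsewhere the default slice 0 gives a constant.
  have e : (fun t => edist (slice μ g t) v) = {t | MemLp (fun x => g (x, t)) 2 μ}.piecewise
      (fun t => (∫⁻ x, ‖g (x, t) - v x‖ₑ ^ (2 : ℝ) ∂μ) ^ (1 / (2 : ℝ)))
      (fun _ => edist 0 v) := by
    ext t
    by_cases ht : t ∈ {t | MemLp (fun x => g (x, t)) 2 μ}
    · rw [piecewise_eq_of_mem _ _ _ ht, slice_of_memLp ht]
      conv_lhs => rw [← Lp.toLp_coeFn v (Lp.memLp v)]
      rw [Lp.edist_toLp_toLp, eLpNorm_eq_lintegral_rpow_enorm_toReal two_ne_zero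
        ENNReal.ofNat_ne_top]
      rfl
    · rw [piecewise_eq_of_notMem _ _ _ ht, slice_of_not_memLp ht]
  rw [e]
  refine Measurable.piecewise hS (Measurable.pow_const ?_ _) measurable_const
  have : Measurable fun z : α × ℝ => ‖g z - v z.1‖ₑ ^ (2 : ℝ) :=
    (hgm.sub (hv.comp measurable_fst)).enorm.pow_const _
  exact this.lintegral_prod_left'

theorem memLp_slice [SecondCountableTopology E] [IsSeparable μ]
    [MeasurableSpace E] [BorelSpace E] (hf : MemLp f 2 (μ.prod ν)) : MemLp (slice μ f) 2 ν := by
  refine ⟨aestronglyMeasurable_slice hf.1, ?_⟩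
  rw [eLpNorm_lt_top_iff_lintegral_rpow_enorm_lt_top two_ne_zero ENNReal.ofNat_ne_top]
  refine lt_of_eq_of_lt (lintegral_congr_ae ?_) (lintegral_enorm_sq_lt_top hf)
  filter_upwards [ae_memLp_slice hf] with t ht
  rw [slice_of_memLp ht, Lp.enorm_toLp, eLpNorm_eq_lintegral_rpow_enorm_toReal two_ne_zero
    ENNReal.ofNat_ne_top, ← ENNReal.rpow_mul]
  simp

end Slices

/-! ### Material matrices as coercive operators. -/

noncomputable section Operators

namespace Maxwell

variable {Ω : Set E3}

/-! ### Multiplication by a bounded matrix field -/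

/-- Each coordinate is at most 3K‖ξ‖, so the squared norm is at most 27K²‖ξ‖²; the constant 6 rounds
this up to 36. -/
theorem norm_mulVec3_le {A : Matrix (Fin 3) (Fin 3) ℝ} {K : ℝ} (hA : ∀ i k, |A i k| ≤ K)
    (ξ : E3) : ‖mulVec3 A ξ‖ ≤ 6 * K * ‖ξ‖ := by
  have hK : 0 ≤ K := (abs_nonneg _).trans (hA 0 0)
  have hi : ∀ i, ‖mulVec3 A ξ i‖ ≤ 3 * K * ‖ξ‖ := fun i => by
    change ‖∑ k, A i k * ξ k‖ ≤ _
    calc _ ≤ ∑ k : Fin 3, ‖A i k * ξ k‖ := norm_sum_le _ _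
      _ ≤ ∑ _k : Fin 3, K * ‖ξ‖ := by
        refine Finset.sum_le_sum fun k _ => ?_
        rw [norm_mul]
        exact mul_le_mul (hA i k) (PiLp.norm_apply_le ξ k) (norm_nonneg _) hK
      _ = _ := by simp; ring
  refine le_of_sq_le_sq ?_ (by positivity)
  rw [EuclideanSpace.norm_sq_eq]
  calc _ ≤ ∑ _i : Fin 3, (3 * K * ‖ξ‖) ^ 2 :=
        Finset.sum_le_sum fun i _ => pow_le_pow_left₀ (norm_nonneg _) (hi i) 2
    _ ≤ _ := by
      simp only [Finset.sum_const, Finset.card_univ, Fintype.card_fin, nsmul_eq_mul]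
      push_cast
      nlinarith [sq_nonneg (K * ‖ξ‖)]

theorem mulVec3_add (A : Matrix (Fin 3) (Fin 3) ℝ) (ξ η : E3) :
    mulVec3 A (ξ + η) = mulVec3 A ξ + mulVec3 A η := by
  simp [mulVec3, Matrix.mulVec_add]

theorem mulVec3_smul (A : Matrix (Fin 3) (Fin 3) ℝ) (c : ℝ) (ξ : E3) :
    mulVec3 A (c • ξ) = c • mulVec3 A ξ := by
  simp [mulVec3, Matrix.mulVec_smul]

theorem dot_mulVec3_of_isSymm {A : Matrix (Fin 3) (Fin 3) ℝ} (hA : A.IsSymm) (ξ η : E3) :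
    dot (mulVec3 A ξ) η = dot ξ (mulVec3 A η) := by
  have h : ∀ i k, A i k = A k i := fun i k => hA.apply k i
  simp only [dot, mulVec3, PiLp.inner_apply, Matrix.mulVec, dotProduct, Fin.sum_univ_three,
    RCLike.inner_apply, conj_trivial]
  rw [h 1 0, h 2 0, h 2 1]
  ring

/-- The bounded operator on `H` of multiplication by a bounded measurable matrix field. -/
theorem BoundedMeasurable.exists_operator {A : E3 → Matrix (Fin 3) (Fin 3) ℝ}
    (hΩ : MeasurableSet Ω) (hA : BoundedMeasurable Ω A) :
    ∃ m : H Ω →L[ℝ] H Ω, ∀ u, ∀ᵐ x ∂(volume.restrict Ω), m u x = mulVec3 (A x) (u x) := by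
  obtain ⟨hm, K, hK⟩ := hA
  have hmeas : ∀ u : H Ω, AEStronglyMeasurable (fun x => mulVec3 (A x) (u x))
      (volume.restrict Ω) := fun u => by
    have hu : AEMeasurable (fun x => u x) (volume.restrict Ω) :=
      (Lp.aestronglyMeasurable u).aemeasurable
    have hcoord : ∀ k, AEMeasurable (fun x => u x k) (volume.restrict Ω) := fun k =>
      (EuclideanSpace.proj (𝕜 := ℝ) k).continuous.measurable.comp_aemeasurable hu
    have hpi : AEMeasurable (fun x => (A x).mulVec (u x).ofLp) (volume.restrict Ω) := by
      refine aemeasurable_pi_lambda _ fun i => ?_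
      change AEMeasurable (fun x => ∑ k, A x i k * u x k) _
      exact Finset.aemeasurable_fun_sum _ fun k _ => (hm i k).mul (hcoord k)
    exact ((PiLp.continuous_toLp 2 (fun _ : Fin 3 => ℝ)).measurable.comp_aemeasurable
      hpi).aestronglyMeasurable
  have hbound : ∀ u : H Ω, ∀ᵐ x ∂(volume.restrict Ω),
      ‖mulVec3 (A x) (u x)‖ ≤ 6 * K * ‖u x‖ := fun u => by
    filter_upwards [ae_restrict_mem hΩ] with x hx
    exact norm_mulVec3_le (hK x hx) _
  have hLp : ∀ u : H Ω, MemLp (fun x => mulVec3 (A x) (u x)) 2 (volume.restrict Ω) := fun u =>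
    (Lp.memLp u).of_le_mul (hmeas u) (hbound u)
  let m₀ : H Ω →ₗ[ℝ] H Ω :=
    { toFun := fun u => (hLp u).toLp
      map_add' := fun u v => by
        apply Lp.ext
        filter_upwards [(hLp (u + v)).coeFn_toLp, (hLp u).coeFn_toLp, (hLp v).coeFn_toLp,
          Lp.coeFn_add u v, Lp.coeFn_add (hLp u).toLp (hLp v).toLp] with x h1 h2 h3 h4 h5
        rw [h1, h5, Pi.add_apply, h2, h3, h4, Pi.add_apply, mulVec3_add]
      map_smul' := fun c u => by
        apply Lp.ext
        filter_upwards [(hLp (c • u)).coeFn_toLp, (hLp u).coeFn_toLp,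
          Lp.coeFn_smul c u, Lp.coeFn_smul c (hLp u).toLp] with x h1 h2 h3 h4
        rw [h1, RingHom.id_apply, h4, Pi.smul_apply, h2, h3, Pi.smul_apply, mulVec3_smul] }
  refine ⟨m₀.mkContinuous (6 * K) fun u => ?_, fun u => (hLp u).coeFn_toLp⟩
  refine Lp.norm_le_mul_norm_of_ae_le_mul ?_
  filter_upwards [(hLp u).coeFn_toLp, hbound u] with x h1 h2
  change ‖((hLp u).toLp _ : H Ω) x‖ ≤ _
  rwa [h1]

section Multiplier

variable {A : E3 → Matrix (Fin 3) (Fin 3) ℝ} {m : H Ω →L[ℝ] H Ω}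

theorem inner_operator (hm : ∀ u, ∀ᵐ x ∂(volume.restrict Ω), m u x = mulVec3 (A x) (u x))
    (u v : H Ω) : inner ℝ (m u) v = ∫ x in Ω, dot (mulVec3 (A x) (u x)) (v x) := by
  rw [L2.inner_def]
  refine integral_congr_ae ?_
  filter_upwards [hm u] with x hx
  rw [hx]

theorem isCoerciveSymm_operator (hΩ : MeasurableSet Ω)
    (hm : ∀ u, ∀ᵐ x ∂(volume.restrict Ω), m u x = mulVec3 (A x) (u x))
    (hs : ∀ x ∈ Ω, (A x).IsSymm) {a : ℝ} (ha : 0 < a)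
    (hp : ∀ x ∈ Ω, ∀ ξ : E3, a * ‖ξ‖ ^ 2 ≤ dot (mulVec3 (A x) ξ) ξ) :
    IsCoerciveSymm m a := by
  refine ⟨ha, fun u v => ?_, fun u => ?_⟩
  · rw [L2.inner_def, L2.inner_def]
    refine integral_congr_ae ?_
    filter_upwards [hm u, hm v, ae_restrict_mem hΩ] with x h1 h2 hx
    rw [h1, h2]
    exact dot_mulVec3_of_isSymm (hs x hx) _ _
  · rw [← real_inner_self_eq_norm_sq, L2.inner_def, L2.inner_def, ← integral_const_mul]
    refine integral_mono_ae ((L2.integrable_inner (𝕜 := ℝ) u u).const_mul a)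
      (L2.integrable_inner (𝕜 := ℝ) (m u) u) ?_
    filter_upwards [hm u, ae_restrict_mem hΩ] with x h1 hx
    rw [h1, real_inner_self_eq_norm_sq]
    exact hp x hx _

end Multiplier

/-- The operator `(u, v) ↦ (m u, n v)` on `H × H`. -/
def diagOperator (m n : H Ω →L[ℝ] H Ω) : HH Ω →L[ℝ] HH Ω :=
  (WithLp.prodContinuousLinearEquiv 2 ℝ (H Ω) (H Ω)).symm.toContinuousLinearMap ∘L
    (m.prodMap n) ∘L (WithLp.prodContinuousLinearEquiv 2 ℝ (H Ω) (H Ω)).toContinuousLinearMap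

theorem inner_diagOperator (m n : H Ω →L[ℝ] H Ω) (z w : HH Ω) :
    inner ℝ (diagOperator m n z) w = inner ℝ (m z.fst) w.fst + inner ℝ (n z.snd) w.snd :=
  WithLp.prod_inner_apply _ _

theorem isCoerciveSymm_diagOperator {m n : H Ω →L[ℝ] H Ω} {a b : ℝ} (hm : IsCoerciveSymm m a)
    (hn : IsCoerciveSymm n b) : IsCoerciveSymm (diagOperator m n) (min a b) := by
  refine ⟨lt_min hm.pos hn.pos, fun z w => ?_, fun z => ?_⟩
  · rw [inner_diagOperator, ← real_inner_comm z, inner_diagOperator, hm.symm, hn.symm,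
      real_inner_comm z.fst, real_inner_comm z.snd]
  · rw [inner_diagOperator, WithLp.prod_norm_sq_eq_of_L2, mul_add]
    refine add_le_add (le_trans ?_ (hm.le _)) (le_trans ?_ (hn.le _))
    · gcongr
      exact min_le_left _ _
    · gcongr
      exact min_le_right _ _

end Maxwell

end Operators

/-! ### Skew-adjointness of the Maxwell operator. -/

noncomputable section Graph

namespace Maxwell

variable {Ω : Set E3}

theorem contDiff_coord {φ : E3 → E3} (hφ : ContDiff ℝ ∞ φ) (k : Fin 3) :
    ContDiff ℝ ∞ fun x => φ x k :=
  (EuclideanSpace.proj (𝕜 := ℝ) k).contDiff.comp hφ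

theorem hasCompactSupport_coord {φ : E3 → E3} (hφ : HasCompactSupport φ) (k : Fin 3) :
    HasCompactSupport fun x => φ x k :=
  hφ.comp_left (g := fun v : E3 => v k) rfl

theorem pderiv_eq_fderiv_coord {φ : E3 → E3} (hφ : ContDiff ℝ ∞ φ) (i k : Fin 3) (x : E3) :
    pderiv φ i k x = fderiv ℝ (fun y => φ y k) x (EuclideanSpace.single i 1) := by
  have h := (EuclideanSpace.proj (𝕜 := ℝ) k).hasFDerivAt.comp x
    ((hφ.differentiable (by simp)) x).hasFDerivAt
  have e : fderiv ℝ (fun y => φ y k) x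
      = (EuclideanSpace.proj (𝕜 := ℝ) k).comp (fderiv ℝ φ x) := h.fderiv
  rw [e]
  rfl

theorem integrable_coord_mul_pderiv {φ ψ : E3 → E3} (hφ : ContDiff ℝ ∞ φ)
    (hc : HasCompactSupport φ) (hψ : ContDiff ℝ ∞ ψ) (a i k : Fin 3) :
    Integrable fun x => φ x a * pderiv ψ i k x :=
  ((contDiff_coord hφ a).continuous.mul (pderiv_continuous hψ i k)).integrable_of_hasCompactSupport
    (hasCompactSupport_coord hc a).mul_right

theorem integral_coord_mul_pderiv {φ ψ : E3 → E3} (hφ : ContDiff ℝ ∞ φ)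
    (hc : HasCompactSupport φ) (hψ : ContDiff ℝ ∞ ψ) (hc' : HasCompactSupport ψ) (a i k : Fin 3) :
    ∫ x, φ x a * pderiv ψ i k x = - ∫ x, ψ x k * pderiv φ i a x := by
  have h1 := integrable_coord_mul_pderiv hφ hc hψ a i k
  have h2 := integrable_coord_mul_pderiv hψ hc' hφ k i a
  have h3 : Integrable fun x => φ x a * ψ x k :=
    ((contDiff_coord hφ a).continuous.mul
      (contDiff_coord hψ k).continuous).integrable_of_hasCompactSupport
      (hasCompactSupport_coord hc a).mul_right
  simp_rw [pderiv_eq_fderiv_coord hφ, pderiv_eq_fderiv_coord hψ] at h1 h2 ⊢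
  rw [integral_mul_fderiv_eq_neg_fderiv_mul_of_integrable (by simpa only [mul_comm] using h2) h1 h3
    (fun x _ => ((contDiff_coord hφ a).differentiable (by simp)) x)
    (fun x _ => ((contDiff_coord hψ k).differentiable (by simp)) x)]
  simp only [mul_comm]

theorem dot_curl (φ ψ : E3 → E3) (x : E3) :
    dot (φ x) (curl ψ x)
      = φ x 0 * pderiv ψ 1 2 x - φ x 0 * pderiv ψ 2 1 x
        + (φ x 1 * pderiv ψ 2 0 x - φ x 1 * pderiv ψ 0 2 x)
        + (φ x 2 * pderiv ψ 0 1 x - φ x 2 * pderiv ψ 1 0 x) := by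
  simp [dot, curl, PiLp.inner_apply, Fin.sum_univ_three]
  ring

/-- The curl is formally self-adjoint on smooth fields of compact support. -/
theorem integral_dot_curl {φ ψ : E3 → E3} (hφ : ContDiff ℝ ∞ φ)
    (hc : HasCompactSupport φ) (hψ : ContDiff ℝ ∞ ψ) (hc' : HasCompactSupport ψ) :
    ∫ x, dot (φ x) (curl ψ x) = ∫ x, dot (curl φ x) (ψ x) := by
  have hI := integrable_coord_mul_pderiv hφ hc hψ
  have hI' := integrable_coord_mul_pderiv hψ hc' hφ
  have hP := integral_coord_mul_pderiv hφ hc hψ hc'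
  have expand : ∀ {φ ψ : E3 → E3},
      (∀ a i k, Integrable fun x => φ x a * pderiv ψ i k x) →
      ∫ x, dot (φ x) (curl ψ x)
        = (∫ x, φ x 0 * pderiv ψ 1 2 x) - (∫ x, φ x 0 * pderiv ψ 2 1 x)
        + ((∫ x, φ x 1 * pderiv ψ 2 0 x) - ∫ x, φ x 1 * pderiv ψ 0 2 x)
        + ((∫ x, φ x 2 * pderiv ψ 0 1 x) - ∫ x, φ x 2 * pderiv ψ 1 0 x) := by
    intro φ ψ h
    have hd : ∀ a i k i' k', Integrable fun x =>
        φ x a * pderiv ψ i k x - φ x a * pderiv ψ i' k' x :=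
      fun a i k i' k' => (h a i k).sub (h a i' k')
    simp_rw [dot_curl]
    rw [integral_add (by exact (hd 0 1 2 2 1).add (hd 1 2 0 0 2)) (hd _ _ _ _ _),
      integral_add (hd _ _ _ _ _) (hd _ _ _ _ _), integral_sub (h _ _ _) (h _ _ _),
      integral_sub (h _ _ _) (h _ _ _), integral_sub (h _ _ _) (h _ _ _)]
  have hsymm : ∫ x, dot (curl φ x) (ψ x) = ∫ x, dot (ψ x) (curl φ x) := by
    simp only [dot, real_inner_comm]
  rw [hsymm, expand hI, expand hI']
  simp only [hP]
  ring

theorem setIntegral_dot_eq_integral {φ ψ : E3 → E3} (h : tsupport φ ⊆ Ω) :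
    ∫ x in Ω, dot (φ x) (ψ x) = ∫ x, dot (φ x) (ψ x) := by
  refine setIntegral_eq_integral_of_forall_compl_eq_zero fun x hx => ?_
  rw [image_eq_zero_of_notMem_tsupport fun h' => hx (h h'), dot, inner_zero_left]

theorem mem_V₀_iff_inner (w : HH Ω) : w ∈ V₀ Ω ↔
    w ∈ V Ω ∧ ∀ ψ ∈ V Ω, inner ℝ w.snd ψ.fst = inner ℝ w.fst ψ.snd := by
  simp only [L2.inner_def]
  rfl

/-- A test field, together with its curl, as an element of `H × H`. -/
theorem IsTestField.exists_mem_V₀ {φ : E3 → E3} (hφ : IsTestField Ω φ) :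
    ∃ w ∈ V₀ Ω, w.fst =ᵐ[volume.restrict Ω] φ ∧ w.snd =ᵐ[volume.restrict Ω] curl φ := by
  obtain ⟨h1, h2, h3⟩ := hφ
  have hm : MemLp φ 2 (volume.restrict Ω) := h1.continuous.memLp_of_hasCompactSupport h2
  have hm' := curl_memLp h1 h2 (volume.restrict Ω)
  refine ⟨WithLp.toLp 2 (hm.toLp, hm'.toLp), ⟨?_, fun ψ hψ => ?_⟩, hm.coeFn_toLp, hm'.coeFn_toLp⟩
  · intro η hη
    calc ∫ x in Ω, dot (hm.toLp _ x) (curl η x) = ∫ x in Ω, dot (φ x) (curl η x) := by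
          refine integral_congr_ae ?_
          filter_upwards [hm.coeFn_toLp] with x hx
          rw [hx]
      _ = ∫ x, dot (φ x) (curl η x) := setIntegral_dot_eq_integral h3
      _ = ∫ x, dot (curl φ x) (η x) := integral_dot_curl h1 h2 hη.1 hη.2.1
      _ = ∫ x in Ω, dot (curl φ x) (η x) := by
          simp only [dot, real_inner_comm (η _)]
          exact (setIntegral_dot_eq_integral hη.2.2).symm
      _ = ∫ x in Ω, dot (hm'.toLp _ x) (η x) := by
          refine integral_congr_ae ?_
          filter_upwards [hm'.coeFn_toLp] with x hx
          rw [hx]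
  -- A test field satisfies the boundary condition because its pairing with ψ ∈ V is the definition
  -- of the weak curl of ψ.
  · calc ∫ x in Ω, dot (hm'.toLp _ x) (ψ.fst x) = ∫ x in Ω, dot (ψ.fst x) (curl φ x) := by
          refine integral_congr_ae ?_
          filter_upwards [hm'.coeFn_toLp] with x hx
          rw [hx, dot, real_inner_comm]
      _ = ∫ x in Ω, dot (ψ.snd x) (φ x) := hψ φ ⟨h1, h2, h3⟩
      _ = ∫ x in Ω, dot (hm.toLp _ x) (ψ.snd x) := by
          refine integral_congr_ae ?_
          filter_upwards [hm.coeFn_toLp] with x hx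
          rw [hx, dot, real_inner_comm]

/-- `V` is determined by duality with `V₀`. -/
theorem mem_V_of_inner {w : HH Ω}
    (h : ∀ φ ∈ V₀ Ω, inner ℝ w.snd φ.fst = inner ℝ w.fst φ.snd) : w ∈ V Ω := by
  intro φ hφ
  obtain ⟨z, hz, h1, h2⟩ := hφ.exists_mem_V₀
  have := h z hz
  rw [L2.inner_def, L2.inner_def] at this
  calc _ = ∫ x in Ω, inner ℝ (w.fst x) (z.snd x) := by
        refine integral_congr_ae ?_
        filter_upwards [h2] with x hx
        rw [hx]
    _ = _ := this.symm
    _ = _ := by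
        refine integral_congr_ae ?_
        filter_upwards [h1] with x hx
        rw [hx]

/-- `V₀` is determined by duality with `V`. -/
theorem mem_V₀_of_inner {w : HH Ω}
    (h : ∀ ψ ∈ V Ω, inner ℝ w.snd ψ.fst = inner ℝ w.fst ψ.snd) : w ∈ V₀ Ω :=
  (mem_V₀_iff_inner w).2 ⟨mem_V_of_inner fun φ hφ => h φ hφ.1, h⟩

section Swap

variable {Y : Type*} [NormedAddCommGroup Y] [InnerProductSpace ℝ Y]

/-- The map `((e, h), (a, b)) ↦ (e, -b)`. -/
def electricPair : WithLp 2 (Y × Y) × WithLp 2 (Y × Y) →ₗ[ℝ] WithLp 2 (Y × Y) where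
  toFun p := WithLp.toLp 2 (p.1.fst, -p.2.snd)
  map_add' _ _ := WithLp.ofLp_injective 2 (Prod.ext rfl (neg_add _ _))
  map_smul' _ _ := WithLp.ofLp_injective 2 (Prod.ext rfl (smul_neg _ _).symm)

/-- The map `((e, h), (a, b)) ↦ (h, a)`. -/
def magneticPair : WithLp 2 (Y × Y) × WithLp 2 (Y × Y) →ₗ[ℝ] WithLp 2 (Y × Y) where
  toFun p := WithLp.toLp 2 (p.1.snd, p.2.fst)
  map_add' _ _ := rfl
  map_smul' _ _ := rfl

end Swap

/-- The graph of the Maxwell operator `(e, h) ↦ (curl h, -curl e)` on `V₀ × V`. -/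
def maxwellGraph (Ω : Set E3) : Submodule ℝ (HH Ω × HH Ω) :=
  (V₀ Ω).comap electricPair ⊓ (V Ω).comap magneticPair

theorem mem_maxwellGraph (p : HH Ω × HH Ω) : p ∈ maxwellGraph Ω ↔
    WithLp.toLp 2 (p.1.fst, -p.2.snd) ∈ V₀ Ω ∧ WithLp.toLp 2 (p.1.snd, p.2.fst) ∈ V Ω :=
  Iff.rfl

/-- V and V₀ are each other's annihilators for the form ⟨w.snd, z.fst⟩ - ⟨w.fst, z.snd⟩. Elements of
the graph with one vanishing field test the two memberships separately; single-valuedness is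
uniqueness of the weak curl. -/
theorem isSkewAdjointGraph_maxwellGraph (hΩ : IsOpen Ω) :
    IsSkewAdjointGraph (maxwellGraph Ω) := by
  refine ⟨fun u v => ⟨fun hp q hq => ?_, fun h => (mem_maxwellGraph _).2
    ⟨mem_V₀_of_inner fun ψ hψ => ?_, mem_V_of_inner fun φ hφ => ?_⟩⟩, fun v hv => ?_⟩
  · obtain ⟨h1, h2⟩ := (mem_maxwellGraph _).1 hp
    obtain ⟨h3, h4⟩ := (mem_maxwellGraph _).1 hq
    have e1 : inner ℝ (-v.snd) q.1.snd = inner ℝ u.fst q.2.fst :=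
      ((mem_V₀_iff_inner _).1 h1).2 _ h4
    have e2 : inner ℝ (-q.2.snd) u.snd = inner ℝ q.1.fst v.fst :=
      ((mem_V₀_iff_inner _).1 h3).2 _ h2
    rw [inner_neg_left] at e1 e2
    rw [real_inner_comm, real_inner_comm v.fst] at e2
    have e3 : inner ℝ u q.2 = inner ℝ u.fst q.2.fst + inner ℝ u.snd q.2.snd :=
      WithLp.prod_inner_apply _ _
    have e4 : inner ℝ v q.1 = inner ℝ v.fst q.1.fst + inner ℝ v.snd q.1.snd :=
      WithLp.prod_inner_apply _ _
    linarith
  · have hq : ((WithLp.toLp 2 (0, ψ.fst), WithLp.toLp 2 (ψ.snd, 0)) : HH Ω × HH Ω)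
        ∈ maxwellGraph Ω := by
      refine (mem_maxwellGraph _).2 ⟨?_, hψ⟩
      have e : (WithLp.toLp 2 ((0 : H Ω), -(0 : H Ω)) : HH Ω) = 0 :=
        WithLp.ofLp_injective 2 (Prod.ext rfl neg_zero)
      exact (congrArg (· ∈ V₀ Ω) e).mpr (V₀ Ω).zero_mem
    have := h _ hq
    rw [WithLp.prod_inner_apply, WithLp.prod_inner_apply] at this
    simp only [inner_zero_right, add_zero, zero_add] at this
    change inner ℝ (-v.snd) ψ.fst = inner ℝ u.fst ψ.snd
    rw [inner_neg_left]
    change inner ℝ u.fst ψ.snd + inner ℝ v.snd ψ.fst = 0 at this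
    linarith
  · have hq : ((WithLp.toLp 2 (φ.fst, 0), WithLp.toLp 2 (0, -φ.snd)) : HH Ω × HH Ω)
        ∈ maxwellGraph Ω := by
      refine (mem_maxwellGraph _).2 ⟨?_, (V Ω).zero_mem⟩
      have e : (WithLp.toLp 2 (φ.fst, -(-φ.snd)) : HH Ω) = φ :=
        WithLp.ofLp_injective 2 (Prod.ext rfl (neg_neg _))
      exact (congrArg (· ∈ V₀ Ω) e).mpr hφ
    have := h _ hq
    rw [WithLp.prod_inner_apply, WithLp.prod_inner_apply] at this
    simp only [inner_zero_right, add_zero, zero_add, inner_neg_right] at this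
    change -inner ℝ u.snd φ.snd + inner ℝ v.fst φ.fst = 0 at this
    change inner ℝ v.fst φ.fst = inner ℝ u.snd φ.snd
    linarith
  · obtain ⟨h1, h2⟩ := (mem_maxwellGraph _).1 hv
    have h0 : HasWeakCurl (0 : H Ω) 0 := (V Ω).zero_mem
    have h1 : HasWeakCurl (0 : H Ω) (-v.snd) := h1.1
    have h2 : HasWeakCurl (0 : H Ω) v.fst := h2
    have e1 : v.snd = 0 := neg_eq_zero.1 (h1.unique hΩ h0)
    have e2 : v.fst = 0 := h2.unique hΩ h0
    exact WithLp.ofLp_injective 2 (Prod.ext e2 e1)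

end Maxwell

end Graph

/-! ### From Maxwell's equations to the abstract evolution equation. -/

noncomputable section Reduction

namespace Maxwell

variable {Ω : Set E3} {T : ℝ}

/-! ### Separated test functions -/

theorem memLp_smul_const {Y : Type*} [NormedAddCommGroup Y] [NormedSpace ℝ Y] {ζ : ℝ → ℝ}
    (hζ : Continuous ζ) (v : Y) : MemLp (fun t => ζ t • v) 2 (volume.restrict (Ioo 0 T)) := by
  have hc : Continuous fun t => ζ t • v := hζ.smul continuous_const
  obtain ⟨C, hC⟩ := isCompact_Icc.exists_bound_of_continuousOn (hc.continuousOn (s := Icc 0 T))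
  refine MemLp.of_bound hc.aestronglyMeasurable C ?_
  filter_upwards [ae_restrict_mem measurableSet_Ioo] with t ht
  exact hC t (Ioo_subset_Icc_self ht)

/-- Separated test functions are all that the abstract formulation uses. Only ζ(T) = 0 is imposed,
so ζ(0) still sees the initial data. -/
theorem isAdmissible_smul (hT : 0 < T) {W : Submodule ℝ (HH Ω)} (φ : W) {ζ : ℝ → ℝ}
    (hζ : ContDiff ℝ ∞ ζ) (hζT : ζ T = 0) :
    IsAdmissible T W (fun t => ζ t • φ) (fun t => deriv ζ t • (φ : HH Ω).fst)
      (fun t => ζ t • (φ : HH Ω).fst) := by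
  have hd : Continuous (deriv ζ) := hζ.continuous_deriv (by simp)
  refine ⟨memLp_smul_const hζ.continuous φ, memLp_smul_const hd _, fun η hη _ hs => ?_,
    (hζ.continuous.smul continuous_const).continuousOn, Filter.Eventually.of_forall fun _ => rfl,
    by simp only [hζT, zero_smul]⟩
  have hη0 : η 0 = 0 := image_eq_zero_of_notMem_tsupport fun h => (hs h).1.false
  have hηT : η T = 0 := image_eq_zero_of_notMem_tsupport fun h => (hs h).2.false
  have hηd : Continuous (deriv η) := hη.continuous_deriv (by simp)
  have key := intervalIntegral.integral_mul_deriv_eq_deriv_mul (a := 0) (b := T)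
    (fun x _ => ((hη.differentiable (by simp)) x).hasDerivAt)
    (fun x _ => ((hζ.differentiable (by simp)) x).hasDerivAt)
    (hηd.intervalIntegrable _ _) (hd.intervalIntegrable _ _)
  rw [hη0, hηT, intervalIntegral.integral_of_le hT.le, intervalIntegral.integral_of_le hT.le,
    integral_Ioc_eq_integral_Ioo, integral_Ioc_eq_integral_Ioo] at key
  change ∫ t in Ioo 0 T, deriv η t • ζ t • (φ : HH Ω).fst
    = -∫ t in Ioo 0 T, η t • deriv ζ t • (φ : HH Ω).fst
  simp_rw [smul_smul]
  rw [integral_smul_const, integral_smul_const, key, ← neg_smul]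
  congr 1
  ring

/-! ### The current -/

/-- Superposition with a Carathéodory function preserves measurability. -/
theorem aemeasurable_superposition {α E F : Type*} [MeasurableSpace α] {ν : Measure α}
    [NormedAddCommGroup E] [MeasurableSpace E] [BorelSpace E]
    [NormedAddCommGroup F] [MeasurableSpace F] [BorelSpace F] [SecondCountableTopology F]
    {k : α → E → F} (hk : ∀ ξ, AEMeasurable (fun p => k p ξ) ν)
    (hc : ∀ᵐ p ∂ν, Continuous (k p)) {f : α → E} (hf : StronglyMeasurable f) :
    AEMeasurable (fun p => k p (f p)) ν := by
  refine aemeasurable_of_tendsto_metrizable_ae Filter.atTop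
    (f := fun n p => k p (hf.approx n p)) (fun n => ?_) ?_
  · have e : (fun p => k p (hf.approx n p))
        = fun p => ∑ y ∈ (hf.approx n).range,
          (hf.approx n ⁻¹' {y}).indicator (fun p => k p y) p := by
      ext p
      rw [Finset.sum_eq_single (hf.approx n p)]
      · rw [indicator_of_mem (by simp)]
      · intro y _ hy
        exact indicator_of_notMem (fun h => hy h.symm) _
      · intro h
        exact absurd (SimpleFunc.mem_range_self _ _) h
    rw [e]
    exact Finset.aemeasurable_fun_sum _ fun y _ =>
      (hk y).indicator ((hf.approx n).measurableSet_fiber y)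
  · filter_upwards [hc] with p hp
    exact (hp.tendsto _).comp (hf.tendsto_approx p)

theorem restrict_QT (Ω : Set E3) (T : ℝ) :
    volume.restrict (QT Ω T) = (volume.restrict Ω).prod (volume.restrict (Ioo 0 T)) := by
  rw [Measure.prod_restrict, ← Measure.volume_eq_prod, QT]

/-- Linear growth of `j₁` keeps the superposition in L², which allows the nonlinear current to serve
as a given source. -/
theorem memLp_current (hΩ : MeasurableSet Ω) {j₀ : E3 × ℝ → E3} {j₁ j : E3 × ℝ → E3 → E3}
    (hj : ∀ p ξ, j p ξ = j₀ p + j₁ p ξ) (hj₀ : MemLp j₀ 2 (volume.restrict (QT Ω T)))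
    (hj₁ : IsCaratheodory Ω T j₁)
    (hb : ∃ c₁ : ℝ, 0 < c₁ ∧ ∀ p ∈ QT Ω T, ∀ ξ : E3, ‖j₁ p ξ‖ ≤ c₁ * ‖ξ‖) (e : L2Q Ω T) :
    MemLp (fun p => j p (e p)) 2 (volume.restrict (QT Ω T)) := by
  obtain ⟨c₁, -, hb⟩ := hb
  simp_rw [hj]
  refine hj₀.add ((Lp.memLp e).of_le_mul (c := c₁)
    (aemeasurable_superposition hj₁.1 hj₁.2 (Lp.stronglyMeasurable e)).aestronglyMeasurable ?_)
  filter_upwards [ae_restrict_mem (hΩ.prod measurableSet_Ioo)] with p hp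
  exact hb p hp _

/-! ### Time slices -/

/-- The slice `f(·,t) ∈ H`. -/
abbrev sliceH (Ω : Set E3) (f : E3 × ℝ → E3) (t : ℝ) : H Ω := slice (volume.restrict Ω) f t

theorem coeFn_sliceH {f : E3 × ℝ → E3} (hf : MemLp f 2 (volume.restrict (QT Ω T))) :
    ∀ᵐ t ∂(volume.restrict (Ioo 0 T)), ∀ᵐ x ∂(volume.restrict Ω), sliceH Ω f t x = f (x, t) :=
  coeFn_slice (restrict_QT Ω T ▸ hf)

theorem memLp_sliceH {f : E3 × ℝ → E3} (hf : MemLp f 2 (volume.restrict (QT Ω T))) :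
    MemLp (sliceH Ω f) 2 (volume.restrict (Ioo 0 T)) :=
  memLp_slice (restrict_QT Ω T ▸ hf)

/-- The pair of slices `(e(·,t), h(·,t)) ∈ H × H`. -/
def slicePair (Ω : Set E3) (e h : E3 × ℝ → E3) (t : ℝ) : HH Ω :=
  WithLp.toLp 2 (sliceH Ω e t, sliceH Ω h t)

/-- The forcing `(f(·,t), 0) ∈ H × H`. -/
def electricSource (Ω : Set E3) (f : E3 × ℝ → E3) (t : ℝ) : HH Ω :=
  WithLp.toLp 2 (sliceH Ω f t, 0)

theorem integrableOn_mul_inner {u : ℝ → H Ω} (hu : MemLp u 2 (volume.restrict (Ioo 0 T)))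
    {ζ : ℝ → ℝ} (hζ : Continuous ζ) (v : H Ω) :
    IntegrableOn (fun t => ζ t * inner ℝ (u t) v) (Ioo 0 T) := by
  have h := (innerSL ℝ).memLp_of_bilin 1 hu (memLp_smul_const (T := T) hζ v)
  refine (memLp_one_iff_integrable.1 h).congr (Filter.Eventually.of_forall fun t => ?_)
  change inner ℝ (u t) (ζ t • v) = _
  rw [inner_smul_right]

/-- For p in the graph, the electric equation tested with ζ p.1.fst and the magnetic one with ζ
p.1.snd add up to the abstract weak equation. The curls of these fields are `-p.2.snd` and
`p.2.fst`, hence the signs. -/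
theorem IsWeakSolution.isEvolutionSolution (hT : 0 < T)
    {ε μ : E3 → Matrix (Fin 3) (Fin 3) ℝ} {j : E3 × ℝ → E3 → E3} {e₀ h₀ : H Ω} {e h : L2Q Ω T}
    (hs : IsWeakSolution Ω T ε μ j e₀ h₀ e h)
    (hj : MemLp (fun p => j p (e p)) 2 (volume.restrict (QT Ω T))) {m n : H Ω →L[ℝ] H Ω}
    (hm : ∀ u, ∀ᵐ x ∂(volume.restrict Ω), m u x = mulVec3 (ε x) (u x))
    (hn : ∀ u, ∀ᵐ x ∂(volume.restrict Ω), n u x = mulVec3 (μ x) (u x)) :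
    IsEvolutionSolution (maxwellGraph Ω) (diagOperator m n) T (slicePair Ω e h)
      (electricSource Ω fun p => j p (e p)) (WithLp.toLp 2 (e₀, h₀)) := by
  have he := memLp_sliceH (Lp.memLp e)
  have hh := memLp_sliceH (Lp.memLp h)
  have hJ := memLp_sliceH hj
  have ce := coeFn_sliceH (Lp.memLp e)
  have ch := coeFn_sliceH (Lp.memLp h)
  have cJ := coeFn_sliceH hj
  refine ⟨?_, ?_, fun p hp ζ hζ hζT => ?_⟩
  · rw [← restrict_Ioo_eq_restrict_Ioc]
    exact MemLp.of_fst_of_snd_prodLp ⟨he, hh⟩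
  · rw [← restrict_Ioo_eq_restrict_Ioc]
    exact MemLp.of_fst_of_snd_prodLp ⟨hJ, MemLp.zero⟩
  obtain ⟨h1, h2⟩ := (mem_maxwellGraph _).1 hp
  have hd : Continuous (deriv ζ) := hζ.continuous_deriv (by simp)
  have hel := hs.electric _ _ _ (isAdmissible_smul hT ⟨_, h1⟩ hζ hζT)
  have hma := hs.magnetic _ _ _ (isAdmissible_smul hT ⟨_, h2⟩ hζ hζT)
  have hme : MemLp (fun t => m (sliceH Ω e t)) 2 (volume.restrict (Ioo 0 T)) := m.comp_memLp' he
  have hnh : MemLp (fun t => n (sliceH Ω h t)) 2 (volume.restrict (Ioo 0 T)) := n.comp_memLp' hh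
  have e1 : ∫ t in Ioo 0 T, ∫ x in Ω, dot (mulVec3 (ε x) (e (x, t)))
      ((deriv ζ t • p.1.fst : H Ω) x)
      = ∫ t in Ioo 0 T, deriv ζ t * inner ℝ (m (sliceH Ω e t)) p.1.fst := by
    refine integral_congr_ae ?_
    filter_upwards [ce] with t ht
    rw [← inner_smul_right, inner_operator hm]
    refine integral_congr_ae ?_
    filter_upwards [ht] with x hx
    rw [hx]
  have e2 : ∫ t in Ioo 0 T, ∫ x in Ω, (-dot (h (x, t)) ((ζ t • -p.2.snd : H Ω) x)
        + dot (j (x, t) (e (x, t))) ((ζ t • p.1.fst : H Ω) x))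
      = ∫ t in Ioo 0 T, (ζ t * inner ℝ (sliceH Ω h t) p.2.snd
        + ζ t * inner ℝ (sliceH Ω (fun p => j p (e p)) t) p.1.fst) := by
    refine integral_congr_ae ?_
    filter_upwards [ch, cJ] with t ht ht'
    have : ζ t * inner ℝ (sliceH Ω h t) p.2.snd
        = -inner ℝ (sliceH Ω h t) (ζ t • -p.2.snd) := by
      rw [inner_smul_right, inner_neg_right, mul_neg, neg_neg]
    have hneg : Integrable (fun x => -inner ℝ (sliceH Ω h t x) ((ζ t • -p.2.snd : H Ω) x))
        (volume.restrict Ω) := (L2.integrable_inner (𝕜 := ℝ) _ _).neg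
    rw [this, ← inner_smul_right, L2.inner_def, L2.inner_def, ← integral_neg,
      ← integral_add hneg (L2.integrable_inner (𝕜 := ℝ) _ _)]
    refine integral_congr_ae ?_
    filter_upwards [ht, ht'] with x hx hx'
    rw [hx, hx']
  have e3 : ∫ t in Ioo 0 T, ∫ x in Ω, dot (mulVec3 (μ x) (h (x, t)))
      ((deriv ζ t • p.1.snd : H Ω) x)
      = ∫ t in Ioo 0 T, deriv ζ t * inner ℝ (n (sliceH Ω h t)) p.1.snd := by
    refine integral_congr_ae ?_
    filter_upwards [ch] with t ht
    rw [← inner_smul_right, inner_operator hn]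
    refine integral_congr_ae ?_
    filter_upwards [ht] with x hx
    rw [hx]
  have e4 : ∫ t in Ioo 0 T, ∫ x in Ω, dot (e (x, t)) ((ζ t • p.2.fst : H Ω) x)
      = ∫ t in Ioo 0 T, ζ t * inner ℝ (sliceH Ω e t) p.2.fst := by
    refine integral_congr_ae ?_
    filter_upwards [ce] with t ht
    rw [← inner_smul_right, L2.inner_def]
    refine integral_congr_ae ?_
    filter_upwards [ht] with x hx
    rw [hx]
  have hel' : -(∫ t in Ioo 0 T, deriv ζ t * inner ℝ (m (sliceH Ω e t)) p.1.fst)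
      + (∫ t in Ioo 0 T, (ζ t * inner ℝ (sliceH Ω h t) p.2.snd
        + ζ t * inner ℝ (sliceH Ω (fun p => j p (e p)) t) p.1.fst))
      = ζ 0 * inner ℝ (m e₀) p.1.fst := by
    rw [← e1, ← e2, ← inner_smul_right, inner_operator hm]
    exact hel
  have hma' : -(∫ t in Ioo 0 T, deriv ζ t * inner ℝ (n (sliceH Ω h t)) p.1.snd)
      + (∫ t in Ioo 0 T, ζ t * inner ℝ (sliceH Ω e t) p.2.fst)
      = ζ 0 * inner ℝ (n h₀) p.1.snd := by
    rw [← e3, ← e4, ← inner_smul_right, inner_operator hn]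
    exact hma
  have i1 := integrableOn_mul_inner hme hd p.1.fst
  have i2 := integrableOn_mul_inner hh hζ.continuous p.2.snd
  have i3 := integrableOn_mul_inner hJ hζ.continuous p.1.fst
  have i4 := integrableOn_mul_inner hnh hd p.1.snd
  have i5 := integrableOn_mul_inner he hζ.continuous p.2.fst
  have i23 : IntegrableOn (fun t => ζ t * inner ℝ (sliceH Ω h t) p.2.snd
        + ζ t * inner ℝ (sliceH Ω (fun p => j p (e p)) t) p.1.fst) (Ioo 0 T) := i2.add i3
  have i14 : IntegrableOn (fun t => deriv ζ t * inner ℝ (m (sliceH Ω e t)) p.1.fst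
        + deriv ζ t * inner ℝ (n (sliceH Ω h t)) p.1.snd) (Ioo 0 T) := i1.add i4
  have i235 : IntegrableOn (fun t => (ζ t * inner ℝ (sliceH Ω h t) p.2.snd
        + ζ t * inner ℝ (sliceH Ω (fun p => j p (e p)) t) p.1.fst)
        + ζ t * inner ℝ (sliceH Ω e t) p.2.fst) (Ioo 0 T) := i23.add i5
  have hpt : ∀ t, -(deriv ζ t) * inner ℝ (diagOperator m n (slicePair Ω e h t)) p.1
      + ζ t * (inner ℝ (slicePair Ω e h t) p.2
        + inner ℝ (electricSource Ω (fun p => j p (e p)) t) p.1)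
      = (ζ t * inner ℝ (sliceH Ω h t) p.2.snd
        + ζ t * inner ℝ (sliceH Ω (fun p => j p (e p)) t) p.1.fst
        + ζ t * inner ℝ (sliceH Ω e t) p.2.fst)
        - (deriv ζ t * inner ℝ (m (sliceH Ω e t)) p.1.fst
        + deriv ζ t * inner ℝ (n (sliceH Ω h t)) p.1.snd) := fun t => by
    have a1 : inner ℝ (slicePair Ω e h t) p.2 = inner ℝ (sliceH Ω e t) p.2.fst
        + inner ℝ (sliceH Ω h t) p.2.snd := WithLp.prod_inner_apply _ _
    have a2 : inner ℝ (electricSource Ω (fun p => j p (e p)) t) p.1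
        = inner ℝ (sliceH Ω (fun p => j p (e p)) t) p.1.fst + inner ℝ (0 : H Ω) p.1.snd :=
      WithLp.prod_inner_apply _ _
    have a3 : inner ℝ (diagOperator m n (slicePair Ω e h t)) p.1
        = inner ℝ (m (sliceH Ω e t)) p.1.fst + inner ℝ (n (sliceH Ω h t)) p.1.snd :=
      inner_diagOperator _ _ _ _
    rw [a1, a2, a3, inner_zero_left]
    ring
  have a0 : inner ℝ (diagOperator m n (WithLp.toLp 2 (e₀, h₀))) p.1
      = inner ℝ (m e₀) p.1.fst + inner ℝ (n h₀) p.1.snd := inner_diagOperator _ _ _ _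
  rw [integral_Ioc_eq_integral_Ioo, a0, mul_add, ← hel', ← hma']
  simp_rw [hpt]
  rw [integral_sub i235 i14, integral_add i23 i5, integral_add i1 i4]
  ring

end Maxwell

end Reduction

/-! ### Comparison of two solutions and conclusion. -/

section WellPosedness

theorem IsEvolutionSolution.sub {X : Type*} [NormedAddCommGroup X] [InnerProductSpace ℝ X]
    {G : Submodule ℝ (X × X)} {M : X →L[ℝ] X} {T : ℝ} {w₁ g₁ w₂ g₂ : ℝ → X} {z₁ z₂ : X}
    (h₁ : IsEvolutionSolution G M T w₁ g₁ z₁) (h₂ : IsEvolutionSolution G M T w₂ g₂ z₂) :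
    IsEvolutionSolution G M T (fun t => w₁ t - w₂ t) (fun t => g₁ t - g₂ t) (z₁ - z₂) := by
  refine ⟨h₁.memLp.sub h₂.memLp, h₁.memLp_source.sub h₂.memLp_source, fun p hp ζ hζ hζT => ?_⟩
  have hd : Continuous (deriv ζ) := hζ.continuous_deriv (by simp)
  have hint : ∀ {w g : ℝ → X} {z : X}, IsEvolutionSolution G M T w g z →
      Integrable (fun t => -(deriv ζ t) * inner ℝ (M (w t)) p.1
        + ζ t * (inner ℝ (w t) p.2 + inner ℝ (g t) p.1)) (volume.restrict (Ioc 0 T)) := by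
    intro w g z h
    have hi : ∀ {u : ℝ → X}, IntegrableOn u (Ioc 0 T) → ∀ y : X,
        IntegrableOn (fun t => inner ℝ (u t) y) (Ioc 0 T) := fun hu y =>
      Integrable.inner_const (𝕜 := ℝ) hu y
    have h1 : IntegrableOn (fun t => M (w t)) (Ioc 0 T) := M.integrable_comp h.integrableOn
    have h2 := (hi h.integrableOn p.2).add (hi h.integrableOn_source p.1)
    exact (integrableOn_smul_of_continuous (hi h1 p.1) hd.neg).add
      (integrableOn_smul_of_continuous h2 hζ.continuous)
  have := congrArg₂ (· - ·) (h₁.weak p hp ζ hζ hζT) (h₂.weak p hp ζ hζ hζT)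
  rw [← integral_sub (hint h₁) (hint h₂)] at this
  rw [map_sub, inner_sub_left, mul_sub, ← this]
  refine integral_congr_ae (Filter.Eventually.of_forall fun t => ?_)
  simp only [map_sub, inner_sub_left]
  ring

/-- Comparison of two solutions of a skew-adjoint evolution equation whose sources are
monotonically related. -/
theorem IsEvolutionSolution.exists_continuous_pair {X : Type*} [NormedAddCommGroup X]
    [InnerProductSpace ℝ X] [CompleteSpace X]
    {G : Submodule ℝ (X × X)} {M : X →L[ℝ] X} {a T : ℝ} {w₁ g₁ w₂ g₂ : ℝ → X} {z₁ z₂ : X}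
    (h₁ : IsEvolutionSolution G M T w₁ g₁ z₁) (h₂ : IsEvolutionSolution G M T w₂ g₂ z₂)
    (hT : 0 < T) (hG : IsSkewAdjointGraph G) (hM : IsCoerciveSymm M a)
    (hmono : ∀ᵐ t ∂(volume.restrict (Ioc 0 T)), 0 ≤ inner ℝ (g₁ t - g₂ t) (w₁ t - w₂ t)) :
    ∃ W₁ W₂ : ℝ → X, ContinuousOn W₁ (Icc 0 T) ∧ ContinuousOn W₂ (Icc 0 T) ∧
      (∀ᵐ t ∂(volume.restrict (Ioc 0 T)), W₁ t = w₁ t) ∧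
      (∀ᵐ t ∂(volume.restrict (Ioc 0 T)), W₂ t = w₂ t) ∧ W₁ 0 = z₁ ∧ W₂ 0 = z₂ ∧
      ∀ t ∈ Icc 0 T, inner ℝ (M (W₁ t - W₂ t)) (W₁ t - W₂ t)
        ≤ inner ℝ (M (z₁ - z₂)) (z₁ - z₂) := by
  obtain ⟨W₁, c₁, e₁, i₁, -⟩ := h₁.exists_continuous hT.le hG hM
  obtain ⟨W₂, c₂, e₂, i₂, -⟩ := h₂.exists_continuous hT.le hG hM
  -- The energy identity is needed for the difference itself. Its continuous representative is W₁ -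
  -- W₂, since the two are continuous and agree a.e.
  obtain ⟨W, c, e, -, hW⟩ := (h₁.sub h₂).exists_continuous hT.le hG hM
  have heq : EqOn W (fun t => W₁ t - W₂ t) (Icc 0 T) := by
    refine Measure.eqOn_Icc_of_ae_eq volume hT.ne ?_ c (c₁.sub c₂)
    rw [← restrict_Ioc_eq_restrict_Icc]
    filter_upwards [e, e₁, e₂] with t h h1 h2
    rw [h, h1, h2]
  refine ⟨W₁, W₂, c₁, c₂, e₁, e₂, i₁, i₂, fun t ht => ?_⟩
  have hen := hW t ht
  rw [heq ht] at hen
  rw [hen]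
  have : 0 ≤ ∫ s in Ioc 0 t, inner ℝ (g₁ s - g₂ s) (w₁ s - w₂ s) :=
    integral_nonneg_of_ae
      (ae_restrict_of_ae_restrict_of_subset (Ioc_subset_Ioc_right ht.2) hmono)
  linarith

namespace Maxwell

variable {Ω : Set E3} {T : ℝ}

/-- The magnetic component of the source is 0, so only the pairing of the current difference with e₁
- e₂ remains, and its integrand is nonnegative on almost every slice. -/
theorem electricSource_monotone (hΩ : MeasurableSet Ω) {j : E3 × ℝ → E3 → E3}
    (hmono : ∀ p ∈ QT Ω T, ∀ ξ η : E3, 0 ≤ dot (j p ξ - j p η) (ξ - η))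
    (e₁ h₁ e₂ h₂ : L2Q Ω T) (hj₁ : MemLp (fun p => j p (e₁ p)) 2 (volume.restrict (QT Ω T)))
    (hj₂ : MemLp (fun p => j p (e₂ p)) 2 (volume.restrict (QT Ω T))) :
    ∀ᵐ t ∂(volume.restrict (Ioc 0 T)),
      0 ≤ inner ℝ (electricSource Ω (fun p => j p (e₁ p)) t
        - electricSource Ω (fun p => j p (e₂ p)) t)
        (slicePair Ω e₁ h₁ t - slicePair Ω e₂ h₂ t) := by
  rw [← restrict_Ioo_eq_restrict_Ioc]
  filter_upwards [coeFn_sliceH hj₁, coeFn_sliceH hj₂, coeFn_sliceH (Lp.memLp e₁),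
    coeFn_sliceH (Lp.memLp e₂), ae_restrict_mem measurableSet_Ioo] with t a₁ a₂ b₁ b₂ ht
  have e : inner ℝ (electricSource Ω (fun p => j p (e₁ p)) t
        - electricSource Ω (fun p => j p (e₂ p)) t)
        (slicePair Ω e₁ h₁ t - slicePair Ω e₂ h₂ t)
      = inner ℝ (sliceH Ω (fun p => j p (e₁ p)) t - sliceH Ω (fun p => j p (e₂ p)) t)
          (sliceH Ω e₁ t - sliceH Ω e₂ t)
        + inner ℝ ((0 : H Ω) - 0) (sliceH Ω h₁ t - sliceH Ω h₂ t) :=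
    WithLp.prod_inner_apply _ _
  rw [e, sub_zero, inner_zero_left, add_zero, L2.inner_def]
  refine integral_nonneg_of_ae ?_
  filter_upwards [a₁, a₂, b₁, b₂, Lp.coeFn_sub (sliceH Ω e₁ t) (sliceH Ω e₂ t),
    Lp.coeFn_sub (sliceH Ω (fun p => j p (e₁ p)) t) (sliceH Ω (fun p => j p (e₂ p)) t),
    ae_restrict_mem hΩ] with x p₁ p₂ q₁ q₂ r s hx
  rw [r, s, Pi.sub_apply, Pi.sub_apply, p₁, p₂, q₁, q₂]
  exact hmono (x, t) ⟨hx, ht⟩ _ _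

theorem L2Q_ext_of_slices {u v : L2Q Ω T}
    (h : ∀ᵐ t ∂(volume.restrict (Ioo 0 T)), ∀ᵐ x ∂(volume.restrict Ω), u (x, t) = v (x, t)) :
    u = v := by
  apply Lp.ext
  -- Passing from almost every slice back to the product measure requires a measurable set.
  have hm : MeasurableSet {z : E3 × ℝ | u z = v z} :=
    (Lp.stronglyMeasurable u).measurableSet_eq_fun (Lp.stronglyMeasurable v)
  have h1 : ∀ᵐ z ∂((volume.restrict (Ioo 0 T)).prod (volume.restrict Ω)),
      u (Prod.swap z) = v (Prod.swap z) :=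
    (Measure.ae_prod_iff_ae_ae (measurable_swap hm)).2 h
  have h2 := (Measure.measurePreserving_swap (μ := volume.restrict Ω)
    (ν := volume.restrict (Ioo 0 T))).quasiMeasurePreserving.ae h1
  rw [← restrict_QT] at h2
  exact h2

theorem isContRep_fst {e h : L2Q Ω T} {W : ℝ → HH Ω} (hc : ContinuousOn W (Icc 0 T))
    (hW : ∀ᵐ t ∂(volume.restrict (Ioc 0 T)), W t = slicePair Ω e h t) :
    IsContRep e fun t => (W t).fst := by
  refine ⟨(WithLp.fstL 2 ℝ (H Ω) (H Ω)).continuous.comp_continuousOn hc, ?_⟩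
  rw [← restrict_Ioo_eq_restrict_Ioc] at hW
  filter_upwards [hW, coeFn_sliceH (Lp.memLp e)] with t h1 h2
  rw [h1]
  exact h2

theorem isContRep_snd {e h : L2Q Ω T} {W : ℝ → HH Ω} (hc : ContinuousOn W (Icc 0 T))
    (hW : ∀ᵐ t ∂(volume.restrict (Ioc 0 T)), W t = slicePair Ω e h t) :
    IsContRep h fun t => (W t).snd := by
  refine ⟨(WithLp.sndL 2 ℝ (H Ω) (H Ω)).continuous.comp_continuousOn hc, ?_⟩
  rw [← restrict_Ioo_eq_restrict_Ioc] at hW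
  filter_upwards [hW, coeFn_sliceH (Lp.memLp h)] with t h1 h2
  rw [h1]
  exact h2

theorem IsContRep.eq_of_eqOn {u v : L2Q Ω T} {uc vc : ℝ → H Ω} (hu : IsContRep u uc)
    (hv : IsContRep v vc) (h : EqOn uc vc (Icc 0 T)) : u = v := by
  refine L2Q_ext_of_slices ?_
  filter_upwards [hu.2, hv.2, ae_restrict_mem measurableSet_Ioo] with t h1 h2 ht
  filter_upwards [h1, h2] with x h3 h4
  rw [← h3, ← h4, h (Ioo_subset_Icc_self ht)]

theorem inner_diagOperator_self {A B : E3 → Matrix (Fin 3) (Fin 3) ℝ} {m n : H Ω →L[ℝ] H Ω}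
    (hm : ∀ u, ∀ᵐ x ∂(volume.restrict Ω), m u x = mulVec3 (A x) (u x))
    (hn : ∀ u, ∀ᵐ x ∂(volume.restrict Ω), n u x = mulVec3 (B x) (u x)) (z : HH Ω) :
    inner ℝ (diagOperator m n z) z = weightedSq A z.fst + weightedSq B z.snd := by
  rw [inner_diagOperator, inner_operator hm, inner_operator hn]
  rfl

end Maxwell

end WellPosedness

theorem theorem4p2 (Ω : Set E3) (hΩ : IsOpen Ω)
    (ε μ : E3 → Matrix (Fin 3) (Fin 3) ℝ)
    (hε : BoundedMeasurable Ω ε) (hμ : BoundedMeasurable Ω μ)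
    (hε_symm : ∀ x ∈ Ω, (ε x).IsSymm) (hμ_symm : ∀ x ∈ Ω, (μ x).IsSymm)
    (hε_pos : UniformlyPositive Ω ε) (hμ_pos : UniformlyPositive Ω μ) :
    ∃ C : ℝ, 0 < C ∧
      ∀ (T : ℝ), 0 < T →
      ∀ (j₀ : E3 × ℝ → E3) (j₁ j : E3 × ℝ → E3 → E3),
        (∀ p ξ, j p ξ = j₀ p + j₁ p ξ) →
        MemLp j₀ 2 (volume.restrict (QT Ω T)) →
        IsCaratheodory Ω T j₁ →
        (∃ c₁ : ℝ, 0 < c₁ ∧ ∀ p ∈ QT Ω T, ∀ ξ : E3, ‖j₁ p ξ‖ ≤ c₁ * ‖ξ‖) →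
        (∀ p ∈ QT Ω T, ∀ ξ η : E3, 0 ≤ dot (j p ξ - j p η) (ξ - η)) →
      ∀ (e₀₁ h₀₁ e₀₂ h₀₂ : H Ω) (e₁ h₁ e₂ h₂ : L2Q Ω T),
        IsWeakSolution Ω T ε μ j e₀₁ h₀₁ e₁ h₁ →
        IsWeakSolution Ω T ε μ j e₀₂ h₀₂ e₂ h₂ →
        (∃ ec₁ hc₁ ec₂ hc₂ : ℝ → H Ω,
          IsContRep e₁ ec₁ ∧ IsContRep h₁ hc₁ ∧ IsContRep e₂ ec₂ ∧ IsContRep h₂ hc₂ ∧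
          ec₁ 0 = e₀₁ ∧ hc₁ 0 = h₀₁ ∧ ec₂ 0 = e₀₂ ∧ hc₂ 0 = h₀₂ ∧
          ∀ t ∈ Set.Icc 0 T,
            weightedSq ε (ec₁ t - ec₂ t) + weightedSq μ (hc₁ t - hc₂ t)
                ≤ weightedSq ε (e₀₁ - e₀₂) + weightedSq μ (h₀₁ - h₀₂) ∧
            ‖ec₁ t - ec₂ t‖ ^ 2 + ‖hc₁ t - hc₂ t‖ ^ 2
                ≤ C * (‖e₀₁ - e₀₂‖ ^ 2 + ‖h₀₁ - h₀₂‖ ^ 2)) ∧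
        (e₀₁ = e₀₂ → h₀₁ = h₀₂ → e₁ = e₂ ∧ h₁ = h₂) := by
  obtain ⟨m, hm⟩ := hε.exists_operator hΩ.measurableSet
  obtain ⟨n, hn⟩ := hμ.exists_operator hΩ.measurableSet
  obtain ⟨aε, haε, hpε⟩ := hε_pos
  obtain ⟨aμ, haμ, hpμ⟩ := hμ_pos
  have hM : IsCoerciveSymm (diagOperator m n) (min aε aμ) := isCoerciveSymm_diagOperator
    (isCoerciveSymm_operator hΩ.measurableSet hm hε_symm haε hpε)
    (isCoerciveSymm_operator hΩ.measurableSet hn hμ_symm haμ hpμ)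
  have ha := hM.pos
  -- Coercivity bounds the energy from below and the operator norm bounds it from above; the summand
  -- 1 secures positivity. The choice precedes T, the current and the data.
  refine ⟨(min aε aμ)⁻¹ * (‖diagOperator m n‖ + 1), by positivity, ?_⟩
  intro T hT j₀ j₁ j hj hj₀ hj₁ hb hmono e₀₁ h₀₁ e₀₂ h₀₂ e₁ h₁ e₂ h₂ hs₁ hs₂
  have hJ₁ := memLp_current hΩ.measurableSet hj hj₀ hj₁ hb e₁
  have hJ₂ := memLp_current hΩ.measurableSet hj hj₀ hj₁ hb e₂
  obtain ⟨W₁, W₂, c₁, c₂, a₁, a₂, i₁, i₂, hen⟩ :=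
    (hs₁.isEvolutionSolution hT hJ₁ hm hn).exists_continuous_pair
      (hs₂.isEvolutionSolution hT hJ₂ hm hn) hT
      (isSkewAdjointGraph_maxwellGraph hΩ) hM
      (electricSource_monotone hΩ.measurableSet hmono e₁ h₁ e₂ h₂ hJ₁ hJ₂)
  set z₀ : HH Ω := WithLp.toLp 2 (e₀₁, h₀₁) - WithLp.toLp 2 (e₀₂, h₀₂) with hz₀
  have hbound : ∀ t ∈ Set.Icc 0 T, ‖W₁ t - W₂ t‖ ^ 2
      ≤ (min aε aμ)⁻¹ * (‖diagOperator m n‖ + 1) * ‖z₀‖ ^ 2 := fun t ht => by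
    have h1 := (hM.le (W₁ t - W₂ t)).trans (hen t ht)
    have h2 : inner ℝ (diagOperator m n z₀) z₀ ≤ ‖diagOperator m n‖ * ‖z₀‖ * ‖z₀‖ :=
      (real_inner_le_norm _ _).trans (by gcongr; exact (diagOperator m n).le_opNorm _)
    rw [mul_assoc, inv_mul_eq_div, le_div_iff₀ ha, mul_comm]
    nlinarith [sq_nonneg ‖z₀‖]
  refine ⟨⟨fun t => (W₁ t).fst, fun t => (W₁ t).snd, fun t => (W₂ t).fst, fun t => (W₂ t).snd,
    isContRep_fst c₁ a₁, isContRep_snd c₁ a₁, isContRep_fst c₂ a₂, isContRep_snd c₂ a₂,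
    congrArg WithLp.fst i₁, congrArg WithLp.snd i₁, congrArg WithLp.fst i₂,
    congrArg WithLp.snd i₂,
    fun t ht => ⟨?_, ?_⟩⟩, fun he hh => ?_⟩
  · have := hen t ht
    rw [inner_diagOperator_self hm hn, inner_diagOperator_self hm hn] at this
    exact this
  · have := hbound t ht
    rw [WithLp.prod_norm_sq_eq_of_L2, WithLp.prod_norm_sq_eq_of_L2] at this
    exact this
  -- Equal data make the bound vanish, so the continuous representatives coincide on all of [0, T],
  -- and with them the L² classes.
  · have hz : z₀ = 0 := by rw [hz₀, he, hh, sub_self]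
    have hW : Set.EqOn W₁ W₂ (Set.Icc 0 T) := fun t ht => by
      have := hbound t ht
      rw [hz, norm_zero, zero_pow two_ne_zero, mul_zero] at this
      exact sub_eq_zero.1 (norm_eq_zero.1 (pow_eq_zero_iff two_ne_zero |>.1
        (le_antisymm this (sq_nonneg _))))
    exact ⟨(isContRep_fst c₁ a₁).eq_of_eqOn (isContRep_fst c₂ a₂)
        fun t ht => congrArg WithLp.fst (hW ht),
      (isContRep_snd c₁ a₁).eq_of_eqOn (isContRep_snd c₂ a₂)
        fun t ht => congrArg WithLp.snd (hW ht)⟩
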